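/- Call a sequence of functions $(G_n)_{n\ge 0}$, each holomorphic on $\mathbb C\setminus\{0,-1,-2,\dots\}$, a *hierarchy of multiple gamma functions* if (1) $G_{n}(z+1)=G_{n-1}(z)\,G_{n}(z)$ for $n\ge 1$ and $z\notin\{0,-1,-2,\dots\}$; (2) $G_n(1)=1$ for all $n\ge 0$; (3) for every $n\ge 0$ and real $x\ge 0$, $G_n(x+1)$ is real and positive and $\frac{d^{n+1}}{dx^{n+1}}\log G_n(x+1)\ge 0$; (4) $G_0(z)=z$. Notation: $B_m(t)$ are the Bernoulli polynomials, $\frac{x e^{tx}}{e^x-1}=\sum_{m\ge0}B_m(t)\frac{x^m}{m!}$, and $B_m=B_m(0)$ (so $B_1=-\tfrac12$); $\binom{x}{m}=\frac{x(x-1)\cdots(x-m+1)}{m!}$; the Stirling numbers of the first kind ${}_mS_r$ are given by $u(u-1)\cdots(u-m+1)=\sum_{r=0}^m {}_mS_r\,u^r$; the polynomials $G_{n,j}$ are given by $\binom{z-u}{n-1}=\sum_{j=0}^{n-1}G_{n,j}(z)u^j$; $\zeta$ is the Riemann zeta function and $\gamma$ is Euler's constant. For $n\ge1$ put $$F_n(z)=\sum_{j=0}^{n-1}G_{n,j}(z)Q_j(z)+\sum_{r=0}^{n-2}\left[\frac1{r!}\Big(\frac{\partial}{\partial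 u}\Big)^r\binom{z-u}{n-1}\right]_{u=0}^{u=z}\zeta'(-r)-\gamma\int_0^z\binom{z-u}{n-1}\,du,$$ $$\Phi_n(z,k)=\frac1{(n-1)!}\sum_{\mu=-1}^{n-2}\left\{\sum_{r=\mu+1}^{n-1}\frac{{}_{n-1}S_r}{r-\mu}z^{r-\mu}\right\}(-1)^{\mu+1}k^{\mu},$$ $$Q_j(z)=P_j(z+1)-\sum_{r=0}^j\binom jr z^rP_{j-r}(1)+\frac1{j+1}\sum_{r=1}^{j+1}\binom{j+1}{r}B_{j+1-r}(z)\sum_{l=1}^r\frac{(-1)^{l-1}z^l}{l},$$ $$P_j(x)=\sum_{r=0}^{j+1}\frac{B_r}{r!}\varphi_{j,r}\,x^{j-r+1},\qquad \varphi_{j,r}=\Big(\frac{d}{dt}\Big)^r\left\{\frac{t^{j+1}}{j+1}\log t-\frac{t^{j+1}}{(j+1)^2}\right\}\Bigg|_{t=1}.$$ **Theorem.** A hierarchy of multiple gamma functions exists, and for every such hierarchy, every integer $n\ge 1$ and every $z\in\mathbb C\setminus\{-1,-2,-3,\dots\}$, $$G_n(z+1)=\exp(F_n(z))\prod_{k=1}^\infty\left\{\Big(1+\frac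 zk\Big)^{-\binom{-k}{n-1}}\exp\big(\Phi_n(z,k)\big)\right\},$$ where the infinite product converges absolutely, i.e. if $a_k$ denotes its $k$-th factor then $\sum_{k\ge1}|a_k-1|<\infty$. -/

import Mathlib

open scoped Polynomial

/-- A hierarchy of multiple gamma functions `G₀, G₁, G₂, …`: functions holomorphic on
`ℂ ∖ {0, -1, -2, …}` (values of `G n` at the points `0, -1, -2, …` are irrelevant for `n ≥ 1`) with
`G₀(z) = z`, `Gₙ(z + 1) = Gₙ₋₁(z) Gₙ(z)`, `Gₙ(1) = 1`, and
`(d/dx)ⁿ⁺¹ log Gₙ(x + 1) ≥ 0` for real `x ≥ 0`.  The last condition includes that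
`Gₙ(x + 1)` is real and positive there, so that the real logarithm makes sense. -/
structure IsMultipleGammaHierarchy (G : ℕ → ℂ → ℂ) : Prop where
  holomorphic : ∀ n, DifferentiableOn ℂ (G n) {z | ∀ m : ℕ, z ≠ -(m : ℂ)}
  zero : ∀ z, G 0 z = z
  add_one : ∀ n z, (∀ m : ℕ, z ≠ -(m : ℂ)) → G (n + 1) (z + 1) = G n z * G (n + 1) z
  one : ∀ n, G n 1 = 1
  real_pos : ∀ n (x : ℝ), 0 ≤ x → (G n ((x : ℂ) + 1)).im = 0 ∧ 0 < (G n ((x : ℂ) + 1)).re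
  log_deriv_nonneg : ∀ n (x : ℝ), 0 ≤ x →
    0 ≤ iteratedDeriv (n + 1) (fun t : ℝ => Real.log (G n ((t : ℂ) + 1)).re) x

namespace MultipleGamma

noncomputable section

/-- The polynomials `G_{n,j}(z)` given by `binom(z - u, n - 1) = ∑_{j=0}^{n-1} G_{n,j}(z) u^j`,
i.e. the coefficient of `u^j` in the polynomial `binom(z - u, n - 1) ∈ ℂ[u]`. -/
def coeffG (n j : ℕ) (z : ℂ) : ℂ :=
  (Ring.choose (Polynomial.C z - Polynomial.X : ℂ[X]) (n - 1)).coeff j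

/-- `φ_{j,r} = (d/dt)^r { t^{j+1}/(j+1) · log t - t^{j+1}/(j+1)² }` at `t = 1`. -/
def phi (j r : ℕ) : ℝ :=
  iteratedDeriv r
    (fun t : ℝ => t ^ (j + 1) / (j + 1) * Real.log t - t ^ (j + 1) / ((j : ℝ) + 1) ^ 2) 1

/-- `P_j(x) = ∑_{r=0}^{j+1} B_r / r! · φ_{j,r} x^{j-r+1}`, with `B_1 = -1/2`. -/
def P (j : ℕ) (x : ℂ) : ℂ :=
  ∑ r ∈ Finset.range (j + 2),
    (_root_.bernoulli r : ℂ) / (r.factorial : ℂ) * (phi j r : ℂ) * x ^ (j + 1 - r)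

/-- The Bernoulli polynomial `B_m(z)` at a complex number. -/
def bernoulliPoly (m : ℕ) (z : ℂ) : ℂ :=
  Polynomial.aeval z (Polynomial.bernoulli m)

/-- `Q_j(z) = P_j(z+1) - ∑_{r=0}^{j} binom(j,r) z^r P_{j-r}(1)
  + 1/(j+1) ∑_{r=1}^{j+1} binom(j+1,r) B_{j+1-r}(z) ∑_{l=1}^{r} (-1)^{l-1} z^l / l`. -/
def Q (j : ℕ) (z : ℂ) : ℂ :=
  P j (z + 1) - ∑ r ∈ Finset.range (j + 1), (j.choose r : ℂ) * z ^ r * P (j - r) 1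
    + 1 / ((j : ℂ) + 1) * ∑ r ∈ Finset.Icc 1 (j + 1),
        ((j + 1).choose r : ℂ) * bernoulliPoly (j + 1 - r) z *
          ∑ l ∈ Finset.Icc 1 r, (-1 : ℂ) ^ (l - 1) * z ^ l / (l : ℂ)

/-- The polynomial in the exponential prefactor, for `n ≥ 1`. The last integral is the contour
integral of `u ↦ binom(z - u, n - 1)` along the segment from `0` to `z`. -/
def F (n : ℕ) (z : ℂ) : ℂ :=
  ∑ j ∈ Finset.range n, coeffG n j z * Q j z
    + ∑ r ∈ Finset.range (n - 1),
        (1 / (r.factorial : ℂ) *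
            iteratedDeriv r (fun u : ℂ => Ring.choose (z - u) (n - 1)) z
          - 1 / (r.factorial : ℂ) *
            iteratedDeriv r (fun u : ℂ => Ring.choose (z - u) (n - 1)) 0)
        * deriv riemannZeta (-(r : ℂ))
    - (∫ t in (0 : ℝ)..1, Ring.choose (z - (t : ℂ) * z) (n - 1) * z)
        * (Real.eulerMascheroniConstant : ℂ)

/-- The (signed) Stirling number of the first kind `ₙS_j`: the coefficient of `u^j` in
`u (u - 1) ⋯ (u - n + 1)`. -/
def stirlingS (n j : ℕ) : ℤ :=
  (descPochhammer ℤ n).coeff j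

/-- `Φ_n(z,k) = 1/(n-1)! ∑_{μ=-1}^{n-2} { ∑_{r=μ+1}^{n-1} ₙ₋₁S_r / (r-μ) · z^{r-μ} } (-1)^{μ+1} k^μ`,
written with the index `m = μ + 1` running from `0` to `n - 1`. -/
def Phi (n : ℕ) (z : ℂ) (k : ℕ) : ℂ :=
  1 / ((n - 1).factorial : ℂ) * ∑ m ∈ Finset.range n,
    (∑ r ∈ Finset.Ico m n,
      (stirlingS (n - 1) r : ℂ) / ((r + 1 - m : ℕ) : ℂ) * z ^ (r + 1 - m))
    * (-1 : ℂ) ^ m * (k : ℂ) ^ ((m : ℤ) - 1)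

/-- The `k`-th factor `(1 + z/k)^{-binom(-k, n-1)} exp Φ_n(z,k)`; the exponent is an integer. -/
def weierstrassFactor (n : ℕ) (z : ℂ) (k : ℕ) : ℂ :=
  (1 + z / (k : ℂ)) ^ (-Ring.choose (-(k : ℤ)) (n - 1)) * Complex.exp (Phi n z k)

end

end MultipleGamma

/-!
Let `ζ'(s, y)` be the derivative in `s` of the Hurwitz zeta function, and let `p ↦ ζ'(p, y)` be the
linear functional on polynomials with `X ^ j ↦ ζ'(-j, y)`, so that
`ζ'(p, y + 1) = ζ'(p, y) + p(y) log y`. With `p_x(u) = binom(x - u, m)`, the function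
`L_m(x) = ζ'(p_x, x + 1) - ζ'(p_x, 1)` vanishes at `0` and satisfies
`L_{m+1}(x + 1) = L_{m+1}(x) + L_m(x)` by Pascal's rule, so it is a candidate for
`log G_{m+1}(x + 1)`. Euler–Maclaurin summation gives `ζ'(-j, y)` as a limit of explicit
expressions; comparing those for `y = x + 1` and `y = 1` through the expansion of
`p_0(k) log (1 + x / k)` at `k = ∞` writes `L_m` as `F_{m+1}` plus the logarithms of the Weierstrass
factors. The polynomial part and the `1 / k` term of the expansion make up `Φ`, and summing the
`1 / k` terms produces Euler's constant.

Since `F_{m+1}` has degree at most `m + 1`, the `(m + 2)`-nd derivative of `L_m` is a sum of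
positive terms, and it tends to `0` at `+∞`. For uniqueness, suppose that two hierarchies agree at
one level. Then their logarithms at the next level differ by a `1`-periodic function. If both have
nonnegative derivatives of the same order and one of these derivatives tends to `0`, monotonicity of
the derivatives one order lower forces the difference to be constant, hence zero, on the real axis,
and the identity theorem extends this to the complex domain.
-/

section

open Filter Topology

namespace MultipleGamma

/-! ### Euler–Maclaurin summation -/

theorem hasDerivAt_bernoulliFun_one_sub_div_factorial (M : ℕ) (t : ℝ) :
    HasDerivAt (fun t => -(bernoulliFun (M + 1) (1 - t) / (M + 1).factorial))
      (bernoulliFun M (1 - t) / M.factorial) t := by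
  have hB := (hasDerivAt_bernoulliFun (M + 1) (1 - t)).comp t ((hasDerivAt_id t).const_sub 1)
  refine (hB.div_const ((M + 1).factorial : ℝ)).neg.congr_deriv ?_
  have hM : (M.factorial : ℝ) ≠ 0 := Nat.cast_ne_zero.mpr M.factorial_ne_zero
  rw [Nat.factorial_succ, Nat.add_sub_cancel]
  push_cast
  field_simp

section

variable {E : Type*} [NormedAddCommGroup E] [NormedSpace ℝ E] [CompleteSpace E]

theorem integral_bernoulliFun_one_sub_smul (M : ℕ) {f f' : ℝ → E}
    (hf : ∀ t ∈ Set.uIcc (0 : ℝ) 1, HasDerivAt f (f' t) t)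
    (hf' : IntervalIntegrable f' MeasureTheory.volume 0 1) :
    ∫ t in (0 : ℝ)..1, (bernoulliFun M (1 - t) / M.factorial) • f t =
      (bernoulliFun (M + 1) 1 / (M + 1).factorial) • f 0
        - (bernoulliFun (M + 1) 0 / (M + 1).factorial) • f 1
        + ∫ t in (0 : ℝ)..1, (bernoulliFun (M + 1) (1 - t) / (M + 1).factorial) • f' t := by
  have hcont : Continuous fun t : ℝ => bernoulliFun M (1 - t) / M.factorial := by fun_prop
  have hparts := intervalIntegral.integral_smul_deriv_eq_deriv_smul
    (fun t _ => hasDerivAt_bernoulliFun_one_sub_div_factorial M t) hf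
    (hcont.intervalIntegrable 0 1) hf'
  simp only [neg_smul, intervalIntegral.integral_neg, sub_self, sub_zero] at hparts
  rw [neg_eq_iff_eq_neg.mp hparts]
  abel

theorem sum_bernoulli_smul_sub_eq_integral (g : ℕ → ℝ → E) (w : ℝ)
    (hg : ∀ r, ∀ t ∈ Set.Icc w (w + 1), HasDerivAt (g r) (g (r + 1) t) t) (M : ℕ) :
    ∑ r ∈ Finset.range (M + 2), ((bernoulli r : ℝ) / r.factorial) • (g r (w + 1) - g r w) =
      g 1 w + ∫ t in (0 : ℝ)..1,
        (bernoulliFun (M + 1) (1 - t) / (M + 1).factorial) • g (M + 2) (w + t) := by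
  have hshift : ∀ r, ∀ t ∈ Set.uIcc (0 : ℝ) 1,
      HasDerivAt (fun t => g r (w + t)) (g (r + 1) (w + t)) t := by
    intro r t ht
    rw [Set.uIcc_of_le zero_le_one] at ht
    exact (hg r (w + t) ⟨by linarith [ht.1], by linarith [ht.2]⟩).comp_const_add w t
  have hint : ∀ r, IntervalIntegrable (fun t => g r (w + t)) MeasureTheory.volume 0 1 := fun r =>
    ContinuousOn.intervalIntegrable fun t ht => (hshift r t ht).continuousAt.continuousWithinAt
  have hparts := fun m => integral_bernoulliFun_one_sub_smul m (hshift (m + 1)) (hint (m + 2))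
  induction M with
  | zero =>
    have hmain : g 0 (w + 1) - g 0 w =
        ∫ t in (0 : ℝ)..1, (bernoulliFun 0 (1 - t) / Nat.factorial 0) • g 1 (w + t) := by
      simpa [bernoulliFun] using
        (intervalIntegral.integral_eq_sub_of_hasDerivAt (hshift 0) (hint 1)).symm
    rw [zero_add, Finset.sum_range_succ, Finset.sum_range_one, bernoulli_zero, Nat.factorial_zero,
      Rat.cast_one, Nat.cast_one, div_one, one_smul, hmain, hparts 0, bernoulliFun_eval_one,
      bernoulliFun_eval_zero]
    simp only [zero_add, add_zero, bernoulli_one, if_true, Nat.factorial_one, Nat.cast_one,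
      div_one, smul_sub, add_smul, one_smul]
    abel
  | succ M ih =>
    rw [Finset.sum_range_succ, ih, hparts (M + 1), bernoulliFun_eval_one, bernoulliFun_eval_zero,
      if_neg (by lia), add_zero, add_zero, smul_sub]
    abel

end

theorem tendstoLocallyUniformlyOn_of_summable_norm_sub {X E : Type*} [TopologicalSpace X]
    [LocallyCompactSpace X] [NormedAddCommGroup E] [CompleteSpace E] {F : ℕ → X → E} {U : Set X}
    (hU : IsOpen U)
    (h : ∀ K ⊆ U, IsCompact K → ∃ u : ℕ → ℝ, Summable u ∧
      ∀ᶠ N in atTop, ∀ s ∈ K, ‖F (N + 1) s - F N s‖ ≤ u N) :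
    TendstoLocallyUniformlyOn F (fun s => F 0 s + ∑' N, (F (N + 1) s - F N s)) atTop U := by
  rw [tendstoLocallyUniformlyOn_iff_forall_isCompact hU]
  intro K hKU hK
  obtain ⟨u, hu, hbound⟩ := h K hKU hK
  have hseries := tendstoUniformlyOn_tsum_nat_eventually hu hbound
  rw [Metric.tendstoUniformlyOn_iff] at hseries ⊢
  intro ε hε
  filter_upwards [hseries ε hε] with N hN s hs
  have hdist := hN s hs
  rw [Finset.sum_range_sub (fun N => F N s), dist_eq_norm] at hdist
  rwa [dist_eq_norm, show F 0 s + ∑' N, (F (N + 1) s - F N s) - F N s =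
    ∑' N, (F (N + 1) s - F N s) - (F N s - F 0 s) by abel]

/-! ### Approximations to the Hurwitz zeta function -/

/-- Partial sums of `(s - 1) ζ(s, y)` with `M + 2` Euler–Maclaurin correction terms. The factor
`s - 1` removes the pole, which makes them entire functions of `s`. -/
noncomputable def hurwitzApprox (M N : ℕ) (y : ℝ) (s : ℂ) : ℂ :=
  (s - 1) * ∑ k ∈ Finset.range N, ((y + k : ℝ) : ℂ) ^ (-s) +
    ∑ r ∈ Finset.range (M + 2), ((bernoulli r : ℝ) / r.factorial : ℝ) •
      ((descPochhammer ℂ r).eval (1 - s) * ((y + N : ℝ) : ℂ) ^ (1 - s - r))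

theorem hasDerivAt_descPochhammer_mul_cpow (r : ℕ) (s : ℂ) {t : ℝ} (ht : 0 < t) :
    HasDerivAt (fun t : ℝ => (descPochhammer ℂ r).eval s * (t : ℂ) ^ (s - r))
      ((descPochhammer ℂ (r + 1)).eval s * (t : ℂ) ^ (s - (r + 1 : ℕ))) t := by
  have hpow : HasDerivAt (fun z : ℂ => z ^ (s - r)) ((s - r) * (t : ℂ) ^ (s - r - 1) * 1) (t : ℂ) :=
    (hasDerivAt_id (t : ℂ)).cpow_const (Or.inl (by simpa using ht))
  refine (hpow.comp_ofReal.const_mul ((descPochhammer ℂ r).eval s)).congr_deriv ?_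
  rw [descPochhammer_succ_eval, show (s - (r + 1 : ℕ) : ℂ) = s - r - 1 by push_cast; ring]
  ring

theorem hurwitzApprox_succ_sub (M N : ℕ) {y : ℝ} (hy : 0 < y) (s : ℂ) :
    hurwitzApprox M (N + 1) y s - hurwitzApprox M N y s =
      ∫ t in (0 : ℝ)..1, (bernoulliFun (M + 1) (1 - t) / (M + 1).factorial) •
        ((descPochhammer ℂ (M + 2)).eval (1 - s) *
          ((y + N + t : ℝ) : ℂ) ^ (1 - s - (M + 2 : ℕ))) := by
  have hyN : 0 < y + N := by positivity
  have hEM := sum_bernoulli_smul_sub_eq_integral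
    (fun r t => (descPochhammer ℂ r).eval (1 - s) * (t : ℂ) ^ (1 - s - r)) (y + N)
    (fun r t ht => hasDerivAt_descPochhammer_mul_cpow r (1 - s) (hyN.trans_le ht.1)) M
  have hg₁ : (1 - s - (1 : ℕ) : ℂ) = -s := by push_cast; ring
  simp only [descPochhammer_one, Polynomial.eval_X, hg₁, smul_sub, Finset.sum_sub_distrib] at hEM
  have hcast : (y + (N + 1 : ℕ) : ℝ) = y + N + 1 := by push_cast; ring
  rw [hurwitzApprox, hurwitzApprox, Finset.sum_range_succ, hcast]
  linear_combination hEM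

theorem norm_hurwitzApprox_succ_sub_le (M : ℕ) : ∃ C, ∀ (N : ℕ) (y : ℝ) (s : ℂ), 0 < y →
    1 ≤ N → 1 / 2 - (M : ℝ) ≤ s.re →
    ‖hurwitzApprox M (N + 1) y s - hurwitzApprox M N y s‖ ≤
      C * ‖(descPochhammer ℂ (M + 2)).eval (1 - s)‖ * (N : ℝ) ^ (-(3 / 2) : ℝ) := by
  have hcont : Continuous fun t : ℝ => bernoulliFun (M + 1) (1 - t) / (M + 1).factorial := by
    fun_prop
  obtain ⟨C, hC⟩ := (isCompact_Icc (a := (0 : ℝ)) (b := 1)).exists_bound_of_continuousOn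
    hcont.continuousOn
  refine ⟨C, fun N y s hy hN hs => ?_⟩
  rw [hurwitzApprox_succ_sub M N hy s]
  have hN' : (1 : ℝ) ≤ N := by exact_mod_cast hN
  refine (intervalIntegral.norm_integral_le_of_norm_le_const
    (C := C * ‖(descPochhammer ℂ (M + 2)).eval (1 - s)‖ * (N : ℝ) ^ (-(3 / 2) : ℝ))
    fun t ht => ?_).trans (by simp)
  rw [Set.uIoc_of_le zero_le_one] at ht
  have hbernoulli := hC t ⟨ht.1.le, ht.2⟩
  have hpow : ‖((y + N + t : ℝ) : ℂ) ^ (1 - s - (M + 2 : ℕ))‖ ≤ (N : ℝ) ^ (-(3 / 2) : ℝ) := by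
    rw [Complex.norm_cpow_eq_rpow_re_of_pos (by linarith [ht.1])]
    calc (y + N + t) ^ (1 - s - (M + 2 : ℕ)).re ≤ (y + N + t) ^ (-(3 / 2) : ℝ) := by
          refine Real.rpow_le_rpow_of_exponent_le (by linarith [ht.1]) ?_
          simp only [Complex.sub_re, Complex.one_re, Complex.natCast_re]
          push_cast
          linarith
      _ ≤ (N : ℝ) ^ (-(3 / 2) : ℝ) :=
          Real.rpow_le_rpow_of_nonpos (by linarith) (by linarith [ht.1]) (by norm_num)
  have hC₀ : 0 ≤ C := (norm_nonneg _).trans hbernoulli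
  rw [norm_smul, norm_mul, mul_assoc]
  gcongr

theorem differentiable_hurwitzApprox (M N : ℕ) {y : ℝ} (hy : 0 < y) :
    Differentiable ℂ (hurwitzApprox M N y) := by
  have hcpow : ∀ (k : ℕ) (f : ℂ → ℂ), Differentiable ℂ f →
      Differentiable ℂ fun s => ((y + k : ℝ) : ℂ) ^ f s := fun k f hf =>
    hf.const_cpow (Or.inl (Complex.ofReal_ne_zero.mpr (by positivity)))
  have hpoly : ∀ r, Differentiable ℂ fun s : ℂ => (descPochhammer ℂ r).eval (1 - s) := fun r =>
    (descPochhammer ℂ r).differentiable.comp (differentiable_id.const_sub 1)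
  unfold hurwitzApprox
  refine Differentiable.add (Differentiable.mul (by fun_prop) (.fun_sum fun k _ => ?_))
    (.fun_sum fun r _ => ?_)
  · exact hcpow k _ differentiable_neg
  · exact ((hpoly r).mul (hcpow N _ (by fun_prop))).const_smul ((bernoulli r : ℝ) / r.factorial : ℝ)

theorem tendstoLocallyUniformlyOn_hurwitzApprox (M : ℕ) {y : ℝ} (hy : 0 < y) :
    TendstoLocallyUniformlyOn (fun N => hurwitzApprox M N y)
      (fun s => hurwitzApprox M 0 y s +
        ∑' N, (hurwitzApprox M (N + 1) y s - hurwitzApprox M N y s))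
      atTop {s : ℂ | 1 / 2 - (M : ℝ) < s.re} := by
  refine tendstoLocallyUniformlyOn_of_summable_norm_sub
    (isOpen_lt continuous_const Complex.continuous_re) fun K hKU hK => ?_
  obtain ⟨C, hC⟩ := norm_hurwitzApprox_succ_sub_le M
  have hpoly : Continuous fun s : ℂ => (descPochhammer ℂ (M + 2)).eval (1 - s) := by fun_prop
  obtain ⟨D, hD⟩ := hK.exists_bound_of_continuousOn hpoly.continuousOn
  refine ⟨fun N => |C| * D * (N : ℝ) ^ (-(3 / 2) : ℝ),
    (Real.summable_nat_rpow.mpr (by norm_num)).mul_left _, ?_⟩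
  filter_upwards [eventually_ge_atTop 1] with N hN s hs
  have hDs := hD s hs
  refine (hC N y s hy hN (hKU hs).le).trans ?_
  gcongr
  exact le_abs_self C

theorem tendsto_hurwitzApprox_one_of_one_lt_re (M : ℕ) {s : ℂ} (hs : 1 < s.re) :
    Tendsto (fun N => hurwitzApprox M N 1 s) atTop (𝓝 (riemannZeta₁ s)) := by
  have hs₁ : s ≠ 1 := by rintro rfl; simp at hs
  have hlim : riemannZeta₁ s = (s - 1) * riemannZeta s + ∑ r ∈ Finset.range (M + 2), 0 := by
    rw [riemannZeta_eq_inv_sub_mul hs₁, mul_inv_cancel_left₀ (sub_ne_zero_of_ne hs₁),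
      Finset.sum_const_zero, add_zero]
  rw [hlim]
  refine Tendsto.add (Tendsto.const_mul _ ?_) (tendsto_finsetSum _ fun r _ => ?_)
  · rw [zeta_eq_tsum_one_div_nat_add_one_cpow hs]
    have hsum : Summable fun n : ℕ => 1 / (n + 1 : ℂ) ^ s := by
      simpa using (summable_nat_add_iff 1).mpr (Complex.summable_one_div_nat_cpow.mpr hs)
    refine hsum.hasSum.tendsto_sum_nat.congr fun N => Finset.sum_congr rfl fun k _ => ?_
    rw [Complex.cpow_neg, one_div]
    push_cast
    rw [add_comm]
  · rw [show (0 : ℂ) = ((bernoulli r : ℝ) / r.factorial : ℝ) •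
      ((descPochhammer ℂ r).eval (1 - s) * 0) by rw [mul_zero, smul_zero]]
    refine Tendsto.const_smul (Tendsto.const_mul _ ?_) _
    rw [tendsto_zero_iff_norm_tendsto_zero]
    have hnorm : ∀ N : ℕ,
        ‖((1 + N : ℝ) : ℂ) ^ (1 - s - r)‖ = ((N : ℝ) + 1) ^ (-(s.re + r - 1)) := by
      intro N
      rw [Complex.norm_cpow_eq_rpow_re_of_pos (by positivity), add_comm]
      congr 1
      simp only [Complex.sub_re, Complex.one_re, Complex.natCast_re]
      ring
    simp only [hnorm]
    have hexp : 0 < s.re + r - 1 := by linarith [r.cast_nonneg (α := ℝ)]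
    exact (tendsto_rpow_neg_atTop hexp).comp
      (tendsto_atTop_add_const_right _ _ tendsto_natCast_atTop_atTop)

theorem tendstoLocallyUniformlyOn_hurwitzApprox_one (M : ℕ) :
    TendstoLocallyUniformlyOn (fun N => hurwitzApprox M N 1) riemannZeta₁ atTop
      {s : ℂ | 1 / 2 - (M : ℝ) < s.re} := by
  have hU : IsOpen {s : ℂ | 1 / 2 - (M : ℝ) < s.re} :=
    isOpen_lt continuous_const Complex.continuous_re
  have hlim := tendstoLocallyUniformlyOn_hurwitzApprox M one_pos
  have hdiff := hlim.differentiableOn (.of_forall fun N =>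
    (differentiable_hurwitzApprox M N one_pos).differentiableOn) hU
  have htwo : (2 : ℂ) ∈ {s : ℂ | 1 / 2 - (M : ℝ) < s.re} := by
    rw [Set.mem_ofPred_eq, Complex.re_ofNat]
    linarith [M.cast_nonneg (α := ℝ)]
  refine hlim.congr_right ((hdiff.analyticOnNhd hU).eqOn_of_preconnected_of_eventuallyEq
    (differentiable_riemannZeta₁.differentiableOn.analyticOnNhd hU)
    (convex_halfSpace_re_gt _).isPreconnected htwo ?_)
  have hnhds : {s : ℂ | 1 < s.re} ∈ 𝓝 (2 : ℂ) :=
    (isOpen_lt continuous_const Complex.continuous_re).mem_nhds (by simp)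
  filter_upwards [hnhds] with s (hs : 1 < s.re)
  exact tendsto_nhds_unique (hlim.tendsto_at (show 1 / 2 - (M : ℝ) < s.re by linarith))
    (tendsto_hurwitzApprox_one_of_one_lt_re M hs)

theorem iteratedDeriv_zpow_mul_log (n : ℤ) (a b : ℝ) (r : ℕ) {t : ℝ} (ht : 0 < t) :
    iteratedDeriv r (fun t : ℝ => t ^ n * (a * Real.log t + b)) t =
      t ^ (n - r) * ((descPochhammer ℝ r).eval (n : ℝ) * (a * Real.log t + b) +
        a * (descPochhammer ℝ r).derivative.eval (n : ℝ)) := by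
  induction r generalizing t with
  | zero => simp
  | succ r ih =>
    have hlocal : iteratedDeriv r (fun t : ℝ => t ^ n * (a * Real.log t + b)) =ᶠ[𝓝 t]
        fun t => t ^ (n - r) * ((descPochhammer ℝ r).eval (n : ℝ) * (a * Real.log t + b) +
          a * (descPochhammer ℝ r).derivative.eval (n : ℝ)) := by
      filter_upwards [lt_mem_nhds ht] with u hu using ih hu
    have hderiv := (hasDerivAt_zpow (n - r) t (Or.inl ht.ne')).mul
      (((((Real.hasDerivAt_log ht.ne').const_mul a).add_const b).const_mul
        ((descPochhammer ℝ r).eval (n : ℝ))).add_const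
          (a * (descPochhammer ℝ r).derivative.eval (n : ℝ)))
    rw [iteratedDeriv_succ, hlocal.deriv_eq]
    refine hderiv.deriv.trans ?_
    rw [show n - (r + 1 : ℕ) = n - r - 1 by push_cast; ring, zpow_sub_one₀ ht.ne',
      descPochhammer_succ_right]
    simp only [Polynomial.derivative_mul, Polynomial.derivative_sub, Polynomial.derivative_X,
      Polynomial.derivative_natCast, Polynomial.eval_add, Polynomial.eval_mul, Polynomial.eval_sub,
      Polynomial.eval_X, Polynomial.eval_natCast, sub_zero, mul_one]
    push_cast
    field_simp
    ring

theorem phi_eq (j r : ℕ) : phi j r = (descPochhammer ℝ r).derivative.eval ((j : ℝ) + 1) / (j + 1)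
    - (descPochhammer ℝ r).eval ((j : ℝ) + 1) / (j + 1) ^ 2 := by
  have hfun : (fun t : ℝ => t ^ (j + 1) / (j + 1) * Real.log t - t ^ (j + 1) / ((j : ℝ) + 1) ^ 2) =
      fun t => t ^ ((j + 1 : ℕ) : ℤ) *
        (1 / ((j : ℝ) + 1) * Real.log t + -(1 / ((j : ℝ) + 1) ^ 2)) := by
    ext t
    rw [zpow_natCast]
    ring
  rw [phi, hfun, iteratedDeriv_zpow_mul_log _ _ _ _ one_pos, one_zpow, Real.log_one]
  push_cast
  ring

-- `phi j r` is the `r`-th `t`-derivative at `t = 1` of `∂/∂a (t ^ a / a)` at `a = j + 1`; here the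
-- two differentiations are interchanged.
theorem hasDerivAt_descPochhammer_div (j r : ℕ) :
    HasDerivAt (fun a : ℂ => (descPochhammer ℂ r).eval a / a) (phi j r : ℂ) ((j : ℂ) + 1) := by
  have hj : (j : ℂ) + 1 ≠ 0 := j.cast_add_one_ne_zero
  refine (((descPochhammer ℂ r).hasDerivAt _).div (hasDerivAt_id _) hj).congr_deriv ?_
  have heval : ∀ p : ℤ[X], (((p.map (Int.castRingHom ℝ)).eval ((j : ℝ) + 1) : ℝ) : ℂ) =
      (p.map (Int.castRingHom ℂ)).eval ((j : ℂ) + 1) := by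
    intro p
    rw [← Nat.cast_add_one, ← Nat.cast_add_one, Polynomial.eval_natCast_map,
      Polynomial.eval_natCast_map]
    simp
  have hmap := heval (descPochhammer ℤ r)
  have hmap' := heval (descPochhammer ℤ r).derivative
  simp only [← Polynomial.derivative_map, descPochhammer_map] at hmap hmap'
  rw [phi_eq]
  push_cast
  rw [hmap, hmap', id_eq]
  field_simp

theorem hasDerivAt_descPochhammer_div_mul_cpow (j r : ℕ) {w : ℝ} (hw : 0 < w) :
    HasDerivAt (fun a : ℂ => (descPochhammer ℂ r).eval a / a * (w : ℂ) ^ (a - r))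
      ((phi j r + (descPochhammer ℂ r).eval ((j : ℂ) + 1) / (j + 1) * Real.log w) *
        (w : ℂ) ^ ((j : ℂ) + 1 - r)) ((j : ℂ) + 1) := by
  have hcpow := ((hasDerivAt_id ((j : ℂ) + 1)).sub_const (r : ℂ)).const_cpow
    (Or.inl (Complex.ofReal_ne_zero.mpr hw.ne'))
  refine ((hasDerivAt_descPochhammer_div j r).mul hcpow).congr_deriv ?_
  rw [Complex.ofReal_log hw.le, id_eq]
  ring

theorem bernoulliPoly_succ_div (j : ℕ) (w : ℂ) : bernoulliPoly (j + 1) w / (j + 1) =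
    ∑ r ∈ Finset.range (j + 2), (bernoulli r : ℂ) / r.factorial *
      ((descPochhammer ℂ r).eval ((j : ℂ) + 1) / (j + 1)) * w ^ (j + 1 - r) := by
  rw [bernoulliPoly, Polynomial.bernoulli, map_sum, Finset.sum_div]
  refine Finset.sum_congr rfl fun r _ => ?_
  rw [Polynomial.aeval_monomial, ← Nat.cast_add_one, descPochhammer_eval_eq_descFactorial,
    Nat.descFactorial_eq_factorial_mul_choose]
  have hr : (r.factorial : ℂ) ≠ 0 := Nat.cast_ne_zero.mpr r.factorial_ne_zero
  simp only [eq_ratCast]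
  push_cast
  field_simp

/-- Euler–Maclaurin approximations to the derivative of the Hurwitz zeta function `s ↦ ζ(s, y)` at
`s = -j`. -/
noncomputable def hurwitzDerivApprox (j N : ℕ) (y : ℝ) : ℂ :=
  bernoulliPoly (j + 1) ((y + N : ℝ) : ℂ) / (j + 1) * (Real.log (y + N) : ℂ) +
    P j ((y + N : ℝ) : ℂ) -
    ∑ k ∈ Finset.range N, ((y + k : ℝ) : ℂ) ^ j * (Real.log (y + k) : ℂ)

theorem hurwitzApprox_div_sub_one (M N : ℕ) (y : ℝ) {s : ℂ} (hs : s ≠ 1) :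
    hurwitzApprox M N y s / (s - 1) = ∑ k ∈ Finset.range N, ((y + k : ℝ) : ℂ) ^ (-s) -
      ∑ r ∈ Finset.range (M + 2), (bernoulli r : ℂ) / r.factorial *
        ((descPochhammer ℂ r).eval (1 - s) / (1 - s) * ((y + N : ℝ) : ℂ) ^ (1 - s - r)) := by
  have hcorr : ∀ r : ℕ, (((bernoulli r : ℝ) / r.factorial : ℝ) : ℂ) *
      ((descPochhammer ℂ r).eval (1 - s) * ((y + N : ℝ) : ℂ) ^ (1 - s - r)) / (s - 1) =
      -((bernoulli r : ℂ) / r.factorial *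
        ((descPochhammer ℂ r).eval (1 - s) / (1 - s) * ((y + N : ℝ) : ℂ) ^ (1 - s - r))) :=
    fun r => by
      rw [← neg_sub 1 s, div_neg]
      push_cast
      ring
  simp only [hurwitzApprox, add_div, mul_div_cancel_left₀ _ (sub_ne_zero_of_ne hs),
    Finset.sum_div, Complex.real_smul, hcorr, Finset.sum_neg_distrib, ← sub_eq_add_neg]

theorem sum_phi_add_log_mul_cpow (j : ℕ) (w : ℝ) :
    ∑ r ∈ Finset.range (j + 3), (bernoulli r : ℂ) / r.factorial *
      ((phi j r + (descPochhammer ℂ r).eval ((j : ℂ) + 1) / (j + 1) * Real.log w) *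
        (w : ℂ) ^ ((j : ℂ) + 1 - r)) =
    bernoulliPoly (j + 1) w / (j + 1) * Real.log w + P j w +
      (bernoulli (j + 2) : ℂ) / (j + 2).factorial * phi j (j + 2) * (w : ℂ)⁻¹ := by
  rw [Finset.sum_range_succ, bernoulliPoly_succ_div, P, Finset.sum_mul, ← Finset.sum_add_distrib]
  congr 1
  · refine Finset.sum_congr rfl fun r hr => ?_
    have hexp : (j : ℂ) + 1 - r = (j + 1 - r : ℕ) := by
      rw [Nat.cast_sub (Finset.mem_range_succ_iff.mp hr), Nat.cast_add_one]
    rw [hexp, Complex.cpow_natCast]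
    ring
  · rw [show (j : ℂ) + 1 - (j + 2 : ℕ) = -1 by push_cast; ring, Complex.cpow_neg_one,
      ← Nat.cast_add_one, descPochhammer_eval_coe_nat_of_lt (Nat.lt_succ_self (j + 1))]
    ring

theorem neg_natCast_ne_one (j : ℕ) : -(j : ℂ) ≠ 1 := fun h =>
  j.cast_add_one_ne_zero (R := ℂ) (by linear_combination -h)

theorem hasDerivAt_hurwitzApprox_div_sub_one (j N : ℕ) {y : ℝ} (hy : 0 < y) :
    HasDerivAt (fun s => hurwitzApprox (j + 1) N y s / (s - 1))
      (hurwitzDerivApprox j N y + (bernoulli (j + 2) : ℂ) / (j + 2).factorial * phi j (j + 2) *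
        ((y + N : ℝ) : ℂ)⁻¹) (-j) := by
  have hpos : ∀ k : ℕ, 0 < y + k := fun k => by positivity
  have hexplicit := (eventually_ne_nhds (neg_natCast_ne_one j)).mono fun s hs =>
    hurwitzApprox_div_sub_one (j + 1) N y hs
  have hterm : ∀ k : ℕ, HasDerivAt (fun s : ℂ => ((y + k : ℝ) : ℂ) ^ (-s))
      (-(((y + k : ℝ) : ℂ) ^ j * (Real.log (y + k) : ℂ))) (-j) := fun k => by
    refine ((hasDerivAt_neg (-(j : ℂ))).const_cpow
      (Or.inl (Complex.ofReal_ne_zero.mpr (hpos k).ne'))).congr_deriv ?_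
    rw [neg_neg, Complex.cpow_natCast, Complex.ofReal_log (hpos k).le]
    ring
  have hone_sub : (1 : ℂ) - -j = j + 1 := by ring
  have hcorr : ∀ r : ℕ, HasDerivAt
      (fun s : ℂ => (descPochhammer ℂ r).eval (1 - s) / (1 - s) * ((y + N : ℝ) : ℂ) ^ (1 - s - r))
      (-((phi j r + (descPochhammer ℂ r).eval ((j : ℂ) + 1) / (j + 1) * Real.log (y + N)) *
        ((y + N : ℝ) : ℂ) ^ ((j : ℂ) + 1 - r))) (-j) := fun r => by
    have hcomp := hasDerivAt_descPochhammer_div_mul_cpow j r (hpos N)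
    rw [← hone_sub] at hcomp
    refine (hcomp.comp (-(j : ℂ)) ((hasDerivAt_id _).const_sub 1)).congr_deriv ?_
    rw [hone_sub, mul_neg_one]
  refine (((HasDerivAt.fun_sum fun k _ => hterm k).sub
    (HasDerivAt.fun_sum fun r _ => (hcorr r).const_mul _)).congr_of_eventuallyEq
      hexplicit).congr_deriv ?_
  simp only [mul_neg, Finset.sum_neg_distrib]
  rw [sum_phi_add_log_mul_cpow, hurwitzDerivApprox]
  ring

theorem tendsto_hurwitzDerivApprox_of_tendstoLocallyUniformlyOn (j : ℕ) {y : ℝ} (hy : 0 < y)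
    {f : ℂ → ℂ} (hf : TendstoLocallyUniformlyOn (fun N => hurwitzApprox (j + 1) N y) f atTop
      {s : ℂ | 1 / 2 - ((j + 1 : ℕ) : ℝ) < s.re}) :
    Tendsto (fun N => hurwitzDerivApprox j N y) atTop
      (𝓝 ((deriv f (-j) * (-j - 1) - f (-j)) / (-j - 1) ^ 2)) := by
  have hU : IsOpen {s : ℂ | 1 / 2 - ((j + 1 : ℕ) : ℝ) < s.re} :=
    isOpen_lt continuous_const Complex.continuous_re
  have hj : (-(j : ℂ)) ∈ {s : ℂ | 1 / 2 - ((j + 1 : ℕ) : ℝ) < s.re} := by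
    rw [Set.mem_ofPred_eq, Complex.neg_re, Complex.natCast_re]
    push_cast
    linarith
  have hj₁ : -(j : ℂ) - 1 ≠ 0 := sub_ne_zero_of_ne (neg_natCast_ne_one j)
  have hdiff := fun N => differentiable_hurwitzApprox (j + 1) N hy
  have hquot := ((((hf.deriv (.of_forall fun N => (hdiff N).differentiableOn) hU).tendsto_at
    hj).mul_const (-(j : ℂ) - 1)).sub (hf.tendsto_at hj)).div_const ((-(j : ℂ) - 1) ^ 2)
  have htail : Tendsto (fun N : ℕ => (bernoulli (j + 2) : ℂ) / (j + 2).factorial * phi j (j + 2) *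
      ((y + N : ℝ) : ℂ)⁻¹) atTop (𝓝 0) := by
    have hinv : Tendsto (fun N : ℕ => (y + N)⁻¹) atTop (𝓝 0) := tendsto_inv_atTop_zero.comp
      (tendsto_atTop_add_const_left _ _ tendsto_natCast_atTop_atTop)
    simpa using hinv.ofReal.const_mul
      ((bernoulli (j + 2) : ℂ) / (j + 2).factorial * phi j (j + 2))
  refine (sub_zero ((deriv f (-j) * (-j - 1) - f (-j)) / (-(j : ℂ) - 1) ^ 2) ▸
    hquot.sub htail).congr fun N => ?_
  have hderiv := (((hdiff N) (-j)).hasDerivAt.div ((hasDerivAt_id _).sub_const 1) hj₁).unique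
    (hasDerivAt_hurwitzApprox_div_sub_one j N hy)
  rw [mul_one] at hderiv
  rw [sub_eq_iff_eq_add, ← hderiv, Function.comp_apply]

theorem exists_tendsto_hurwitzDerivApprox (j : ℕ) {y : ℝ} (hy : 0 < y) :
    ∃ Z : ℂ, Tendsto (fun N => hurwitzDerivApprox j N y) atTop (𝓝 Z) :=
  ⟨_, tendsto_hurwitzDerivApprox_of_tendstoLocallyUniformlyOn j hy
    (tendstoLocallyUniformlyOn_hurwitzApprox (j + 1) hy)⟩

theorem tendsto_hurwitzDerivApprox_one (j : ℕ) :
    Tendsto (fun N => hurwitzDerivApprox j N 1) atTop (𝓝 (deriv riemannZeta (-j))) := by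
  have hlim := tendsto_hurwitzDerivApprox_of_tendstoLocallyUniformlyOn j one_pos
    (tendstoLocallyUniformlyOn_hurwitzApprox_one (j + 1))
  have hj := sub_ne_zero_of_ne (neg_natCast_ne_one j)
  rw [deriv_riemannZeta_eq_neg_inv_sub_sq_mul_add (neg_natCast_ne_one j)]
  convert hlim using 2
  field_simp
  ring

/-! ### The expansion of `p(k) log (1 + z / k)` at `k = ∞` -/

/-- The nonnegative powers of `k` in the expansion of `p(k) log (1 + z / k)` at `k = ∞`, as a
polynomial in `k` depending linearly on `p`. -/
noncomputable def logPolynomialPart (z : ℂ) : ℂ[X] →ₗ[ℂ] ℂ[X] :=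
  Polynomial.lsum fun r => LinearMap.toSpanSingleton ℂ ℂ[X]
    (∑ i ∈ Finset.range r, Polynomial.monomial (r - 1 - i) ((-1) ^ i * z ^ (i + 1) / (i + 1)))

/-- The coefficient of `1 / k` in the expansion of `p(k) log (1 + z / k)` at `k = ∞`. -/
noncomputable def logResidue (z : ℂ) : ℂ[X] →ₗ[ℂ] ℂ :=
  Polynomial.lsum fun r => LinearMap.toSpanSingleton ℂ ℂ ((-1) ^ r * z ^ (r + 1) / (r + 1))

/-- The terms of order at least `1 / k` in the expansion of `p(k) log (1 + z / k)` at `k = ∞`. -/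
noncomputable def logPrincipalPart (z k : ℂ) : ℂ[X] →ₗ[ℂ] ℂ :=
  Polynomial.leval k ∘ₗ logPolynomialPart z + k⁻¹ • logResidue z

/-- The remainder, of order `1 / k ^ 2`, of the expansion of `p(k) log (1 + z / k)` at `k = ∞`. -/
noncomputable def logRemainder (z k : ℂ) : ℂ[X] →ₗ[ℂ] ℂ :=
  Complex.log (1 + z / k) • Polynomial.leval k - logPrincipalPart z k

theorem logPrincipalPart_apply (z k : ℂ) (p : ℂ[X]) :
    logPrincipalPart z k p = (logPolynomialPart z p).eval k + k⁻¹ * logResidue z p := by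
  simp [logPrincipalPart]

theorem logRemainder_apply (z k : ℂ) (p : ℂ[X]) :
    logRemainder z k p = Complex.log (1 + z / k) * p.eval k - logPrincipalPart z k p := by
  simp [logRemainder]

theorem logPolynomialPart_monomial (z : ℂ) (r : ℕ) (c : ℂ) :
    logPolynomialPart z (Polynomial.monomial r c) = c • ∑ i ∈ Finset.range r,
      Polynomial.monomial (r - 1 - i) ((-1) ^ i * z ^ (i + 1) / (i + 1)) := by
  rw [logPolynomialPart, Polynomial.lsum_apply, Polynomial.sum_monomial_index _ _ (by simp)]
  simp

theorem logResidue_monomial (z : ℂ) (r : ℕ) (c : ℂ) :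
    logResidue z (Polynomial.monomial r c) = c * ((-1) ^ r * z ^ (r + 1) / (r + 1)) := by
  rw [logResidue, Polynomial.lsum_apply, Polynomial.sum_monomial_index _ _ (by simp)]
  simp

theorem logPrincipalPart_monomial (z : ℂ) {k : ℂ} (hk : k ≠ 0) (r : ℕ) (c : ℂ) :
    logPrincipalPart z k (Polynomial.monomial r c) =
      c * (k ^ r * Complex.logTaylor (r + 2) (z / k)) := by
  rw [logPrincipalPart_apply, logPolynomialPart_monomial, logResidue_monomial, Complex.logTaylor,
    Finset.sum_range_succ', Finset.sum_range_succ, Polynomial.eval_smul, Polynomial.eval_finsetSum,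
    smul_eq_mul, mul_left_comm, ← mul_add, Nat.cast_zero, div_zero, add_zero]
  congr 1
  rw [mul_add, Finset.mul_sum]
  congr 1
  · refine Finset.sum_congr rfl fun i hi => ?_
    have hpow : k ^ r = k ^ (r - 1 - i) * k ^ (i + 1) := by
      rw [← pow_add]
      congr 1
      grind
    rw [Polynomial.eval_monomial, hpow, div_pow]
    push_cast
    field_simp
    ring
  · rw [div_pow]
    push_cast
    field_simp
    ring

theorem norm_logRemainder_monomial_le {z k : ℂ} (hk : k ≠ 0) (hzk : 2 * ‖z‖ ≤ ‖k‖) (r : ℕ)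
    (c : ℂ) : ‖logRemainder z k (Polynomial.monomial r c)‖ ≤
      2 * ‖c‖ * ‖z‖ ^ (r + 2) / ‖k‖ ^ 2 := by
  have hk_pos : 0 < ‖k‖ := norm_pos_iff.mpr hk
  have hhalf : ‖z / k‖ ≤ 1 / 2 := by
    rw [norm_div, div_le_div_iff₀ hk_pos two_pos]
    linarith
  have hinv : (1 - ‖z / k‖)⁻¹ ≤ 2 := by
    rw [inv_le_comm₀ (by linarith) two_pos]
    linarith
  have htaylor : ‖Complex.log (1 + z / k) - Complex.logTaylor (r + 2) (z / k)‖ ≤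
      ‖z / k‖ ^ (r + 2) * 2 := by
    refine (Complex.norm_log_sub_logTaylor_le (r + 1) (by linarith)).trans ?_
    refine (div_le_self ?_ (by norm_cast; lia)).trans ?_
    · exact mul_nonneg (by positivity) (inv_nonneg.mpr (by linarith))
    · gcongr
  have hfactor : logRemainder z k (Polynomial.monomial r c) =
      c * (k ^ r * (Complex.log (1 + z / k) - Complex.logTaylor (r + 2) (z / k))) := by
    rw [logRemainder_apply, logPrincipalPart_monomial z hk, Polynomial.eval_monomial]
    ring
  rw [hfactor, norm_mul, norm_mul, norm_pow]
  calc ‖c‖ * (‖k‖ ^ r * ‖Complex.log (1 + z / k) - Complex.logTaylor (r + 2) (z / k)‖)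
      ≤ ‖c‖ * (‖k‖ ^ r * (‖z / k‖ ^ (r + 2) * 2)) := by gcongr
    _ = 2 * ‖c‖ * ‖z‖ ^ (r + 2) / ‖k‖ ^ 2 := by
      rw [norm_div, div_pow]
      field_simp
      ring

theorem exists_norm_logRemainder_le (p : ℂ[X]) (R : ℝ) :
    ∃ C : ℝ, ∀ z k : ℂ, ‖z‖ ≤ R → k ≠ 0 → 2 * R ≤ ‖k‖ →
      ‖logRemainder z k p‖ ≤ C / ‖k‖ ^ 2 := by
  induction p using Polynomial.induction_on' with
  | add p q hp hq =>
    obtain ⟨C, hC⟩ := hp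
    obtain ⟨D, hD⟩ := hq
    refine ⟨C + D, fun z k hz hk hRk => ?_⟩
    rw [map_add, add_div]
    exact (norm_add_le _ _).trans (add_le_add (hC z k hz hk hRk) (hD z k hz hk hRk))
  | monomial r c =>
    refine ⟨2 * ‖c‖ * R ^ (r + 2), fun z k hz hk hRk => ?_⟩
    refine (norm_logRemainder_monomial_le hk (by linarith) r c).trans ?_
    gcongr

theorem exists_eventually_norm_logRemainder_le (p : ℂ[X]) (R : ℝ) :
    ∃ C : ℝ, ∀ᶠ k : ℕ in atTop, ∀ z : ℂ, ‖z‖ ≤ R →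
      ‖logRemainder z ((k : ℂ) + 1) p‖ ≤ C * (1 / ((k + 1 : ℕ) : ℝ) ^ 2) := by
  obtain ⟨C, hC⟩ := exists_norm_logRemainder_le p R
  refine ⟨C, ?_⟩
  filter_upwards [eventually_ge_atTop ⌈2 * R⌉₊] with k hk z hz
  have hnorm : ‖(k : ℂ) + 1‖ = ((k + 1 : ℕ) : ℝ) := by
    rw [← Nat.cast_add_one, Complex.norm_natCast]
  have hRk : 2 * R ≤ ((k + 1 : ℕ) : ℝ) :=
    (Nat.le_ceil _).trans (Nat.cast_le.mpr (hk.trans k.le_succ))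
  rw [mul_one_div, ← hnorm]
  exact hC z _ hz k.cast_add_one_ne_zero (hnorm ▸ hRk)

theorem summable_one_div_add_one_sq : Summable fun k : ℕ => 1 / ((k + 1 : ℕ) : ℝ) ^ 2 :=
  (summable_nat_add_iff 1).mpr (Real.summable_one_div_nat_pow.mpr one_lt_two)

theorem summable_logRemainder (p : ℂ[X]) (z : ℂ) :
    Summable fun k : ℕ => logRemainder z ((k : ℂ) + 1) p := by
  obtain ⟨C, hC⟩ := exists_eventually_norm_logRemainder_le p ‖z‖
  exact (summable_one_div_add_one_sq.mul_left C).of_norm_bounded_eventually_nat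
    (hC.mono fun k hk => hk z le_rfl)

theorem tendsto_eval_mul_log_sub_logPolynomialPart (p : ℂ[X]) (z : ℂ) :
    Tendsto (fun N : ℕ => Complex.log (1 + z / ((N : ℂ) + 1)) * p.eval ((N : ℂ) + 1) -
      (logPolynomialPart z p).eval ((N : ℂ) + 1)) atTop (𝓝 0) := by
  have hinv : Tendsto (fun N : ℕ => ((N : ℂ) + 1)⁻¹ * logResidue z p) atTop (𝓝 0) := by
    simpa only [one_div, zero_mul] using
      (tendsto_one_div_add_atTop_nhds_zero_nat (𝕜 := ℂ)).mul_const (logResidue z p)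
  have hlim := (summable_logRemainder p z).tendsto_atTop_zero.add hinv
  rw [add_zero] at hlim
  refine hlim.congr fun N => ?_
  rw [logRemainder_apply, logPrincipalPart_apply]
  ring

/-! ### Polynomial functions -/

/-- `f` is a polynomial function of degree at most `d`. -/
def IsPolynomialOfDegreeLE {R : Type*} [Semiring R] (d : ℕ) (f : R → R) : Prop :=
  ∃ p : R[X], p.natDegree ≤ d ∧ ∀ x, f x = p.eval x

namespace IsPolynomialOfDegreeLE

section CommSemiring

variable {R : Type*} [CommSemiring R] {d e : ℕ} {f g : R → R}

theorem eval {p : R[X]} (hp : p.natDegree ≤ d) : IsPolynomialOfDegreeLE d fun x => p.eval x :=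
  ⟨p, hp, fun _ => rfl⟩

theorem mono (hf : IsPolynomialOfDegreeLE d f) (hde : d ≤ e) : IsPolynomialOfDegreeLE e f :=
  let ⟨p, hp, hfp⟩ := hf
  ⟨p, hp.trans hde, hfp⟩

theorem const (c : R) : IsPolynomialOfDegreeLE d fun _ => c :=
  ⟨Polynomial.C c, by simp, by simp⟩

theorem pow {n : ℕ} (hn : n ≤ d) : IsPolynomialOfDegreeLE d fun x : R => x ^ n :=
  ⟨Polynomial.X ^ n, (Polynomial.natDegree_X_pow_le n).trans hn, by simp⟩

theorem add (hf : IsPolynomialOfDegreeLE d f) (hg : IsPolynomialOfDegreeLE d g) :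
    IsPolynomialOfDegreeLE d fun x => f x + g x := by
  obtain ⟨p, hp, hfp⟩ := hf
  obtain ⟨q, hq, hgq⟩ := hg
  exact ⟨p + q, Polynomial.natDegree_add_le_of_degree_le hp hq, by simp [hfp, hgq]⟩

theorem mul (hf : IsPolynomialOfDegreeLE d f) (hg : IsPolynomialOfDegreeLE e g) :
    IsPolynomialOfDegreeLE (d + e) fun x => f x * g x := by
  obtain ⟨p, hp, hfp⟩ := hf
  obtain ⟨q, hq, hgq⟩ := hg
  exact ⟨p * q, Polynomial.natDegree_mul_le_of_le hp hq, by simp [hfp, hgq]⟩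

theorem const_mul (hf : IsPolynomialOfDegreeLE d f) (c : R) :
    IsPolynomialOfDegreeLE d fun x => c * f x :=
  ((const (d := 0) c).mul hf).mono (zero_add d).le

theorem mul_const (hf : IsPolynomialOfDegreeLE d f) (c : R) :
    IsPolynomialOfDegreeLE d fun x => f x * c :=
  hf.mul (const (d := 0) c)

theorem sum {ι : Type*} {s : Finset ι} {f : ι → R → R}
    (hf : ∀ i ∈ s, IsPolynomialOfDegreeLE d (f i)) :
    IsPolynomialOfDegreeLE d fun x => ∑ i ∈ s, f i x := by
  classical
  induction s using Finset.induction_on with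
  | empty => simpa using const 0
  | insert i s hi ih =>
    simp only [Finset.sum_insert hi]
    exact (hf i (s.mem_insert_self i)).add (ih fun k hk => hf k (Finset.mem_insert_of_mem hk))

theorem comp_add_const (hf : IsPolynomialOfDegreeLE d f) (c : R) :
    IsPolynomialOfDegreeLE d fun x => f (x + c) := by
  obtain ⟨p, hp, hfp⟩ := hf
  exact ⟨p.taylor c, by rwa [Polynomial.natDegree_taylor],
    fun x => (hfp _).trans (p.taylor_eval c x).symm⟩

end CommSemiring

theorem sub {R : Type*} [CommRing R] {d : ℕ} {f g : R → R} (hf : IsPolynomialOfDegreeLE d f)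
    (hg : IsPolynomialOfDegreeLE d g) : IsPolynomialOfDegreeLE d fun x => f x - g x := by
  simpa [sub_eq_add_neg] using hf.add (hg.const_mul (-1))

theorem eq_zero_of_tendsto {𝕜 : Type*} [RCLike 𝕜] {d : ℕ} {f : 𝕜 → 𝕜}
    (hf : IsPolynomialOfDegreeLE d f)
    (hlim : Tendsto (fun N : ℕ => f ((N : 𝕜) + 1)) atTop (𝓝 0)) (z : 𝕜) : f z = 0 := by
  obtain ⟨p, -, hfp⟩ := hf
  have hnorm : Tendsto (fun N : ℕ => ‖(N : 𝕜) + 1‖) atTop atTop := by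
    simp only [← Nat.cast_add_one, RCLike.norm_natCast]
    exact tendsto_natCast_atTop_atTop.comp (tendsto_add_atTop_nat 1)
  have hdeg : ¬ 0 < p.degree := fun hp => by
    refine not_tendsto_nhds_of_tendsto_atTop (p.tendsto_norm_atTop hp hnorm) 0 ?_
    simpa [hfp] using hlim.norm
  rw [Polynomial.eq_C_of_degree_le_zero (not_lt.mp hdeg)] at hfp
  simp only [hfp, Polynomial.eval_C] at hlim ⊢
  exact tendsto_nhds_unique tendsto_const_nhds hlim

-- The increments of `N ↦ f (N + 1) - ∑ k < N, g (k + 1)` form a polynomial function of `N` that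
-- tends to zero, so they vanish.
theorem eq_of_tendsto_sub_sum {𝕜 : Type*} [RCLike 𝕜] {d : ℕ} {f g : 𝕜 → 𝕜} {L : 𝕜}
    (hf : IsPolynomialOfDegreeLE d f) (hg : IsPolynomialOfDegreeLE d g)
    (hlim : Tendsto (fun N : ℕ => f ((N : 𝕜) + 1) - ∑ k ∈ Finset.range N, g ((k : 𝕜) + 1))
      atTop (𝓝 L)) : L = f 1 := by
  have hincr : ∀ z, f (z + 1) - f z - g z = 0 := by
    refine (((hf.comp_add_const 1).sub hf).sub hg).eq_zero_of_tendsto ?_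
    have hsub := ((tendsto_add_atTop_iff_nat 1).mpr hlim).sub hlim
    rw [sub_self] at hsub
    refine hsub.congr fun N => ?_
    rw [Finset.sum_range_succ]
    push_cast
    ring
  have hconst : ∀ N : ℕ, f ((N : 𝕜) + 1) - ∑ k ∈ Finset.range N, g ((k : 𝕜) + 1) = f 1 := by
    intro N
    induction N with
    | zero => simp
    | succ N ih =>
      rw [Finset.sum_range_succ, ← ih]
      push_cast
      linear_combination hincr (N + 1)
  exact tendsto_nhds_unique hlim (tendsto_const_nhds.congr fun N => (hconst N).symm)

end IsPolynomialOfDegreeLE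

/-! ### Bernoulli polynomials -/

theorem iterate_derivative_bernoulli (n r : ℕ) :
    Polynomial.derivative^[r] (Polynomial.bernoulli n) =
      (n.descFactorial r : ℚ[X]) * Polynomial.bernoulli (n - r) := by
  induction r with
  | zero => simp
  | succ r ih =>
    rw [Function.iterate_succ_apply', ih, Polynomial.derivative_natCast_mul,
      Polynomial.derivative_bernoulli, Nat.descFactorial_succ, Nat.sub_sub]
    push_cast
    ring

theorem hasseDeriv_bernoulli (n r : ℕ) : Polynomial.hasseDeriv r (Polynomial.bernoulli n) =
    (n.choose r : ℚ[X]) * Polynomial.bernoulli (n - r) := by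
  have hfact := congrFun (Polynomial.factorial_smul_hasseDeriv (R := ℚ) r) (.bernoulli n)
  rw [iterate_derivative_bernoulli, Nat.descFactorial_eq_factorial_mul_choose, LinearMap.smul_apply,
    nsmul_eq_mul, Nat.cast_mul, mul_assoc] at hfact
  exact mul_left_cancel₀ (Nat.cast_ne_zero.mpr r.factorial_ne_zero) hfact

theorem natDegree_bernoulli_le (n : ℕ) : (Polynomial.bernoulli n).natDegree ≤ n :=
  Polynomial.natDegree_sum_le_of_forall_le _ _ fun i _ =>
    (Polynomial.natDegree_monomial_le _).trans (Nat.sub_le n i)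

theorem isPolynomialOfDegreeLE_bernoulliPoly (n : ℕ) : IsPolynomialOfDegreeLE n (bernoulliPoly n) :=
  ⟨(Polynomial.bernoulli n).map (algebraMap ℚ ℂ),
    Polynomial.natDegree_map_le.trans (natDegree_bernoulli_le n),
    fun z => by rw [bernoulliPoly, Polynomial.eval_map_algebraMap]⟩

theorem bernoulliPoly_add (n : ℕ) (x w : ℂ) : bernoulliPoly n (x + w) =
    ∑ r ∈ Finset.range (n + 1), (n.choose r : ℂ) * bernoulliPoly (n - r) x * w ^ r := by
  set p := (Polynomial.bernoulli n).map (algebraMap ℚ ℂ)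
  have hdeg : (p.taylor x).natDegree < n + 1 := by
    rw [Polynomial.natDegree_taylor]
    exact Nat.lt_succ_of_le (Polynomial.natDegree_map_le.trans (natDegree_bernoulli_le n))
  have hcoeff : ∀ r, (p.taylor x).coeff r = n.choose r * bernoulliPoly (n - r) x := fun r => by
    have hmap : Polynomial.hasseDeriv r p =
        (Polynomial.hasseDeriv r (.bernoulli n)).map (algebraMap ℚ ℂ) := by
      ext i
      simp [p, Polynomial.hasseDeriv_coeff]
    rw [Polynomial.taylor_coeff, hmap, hasseDeriv_bernoulli, bernoulliPoly]
    simp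
  rw [bernoulliPoly, ← Polynomial.eval_map_algebraMap, add_comm x, ← Polynomial.taylor_eval,
    Polynomial.eval_eq_sum_range' hdeg]
  simp only [hcoeff]

theorem choose_div_succ {K : Type*} [Field K] [CharZero K] (j r : ℕ) :
    (j.choose r : K) / (r + 1) = ((j + 1).choose (r + 1) : K) / (j + 1) := by
  rw [div_eq_div_iff r.cast_add_one_ne_zero j.cast_add_one_ne_zero]
  exact_mod_cast (mul_comm _ _).trans (Nat.add_one_mul_choose_eq j r)

theorem bernoulliPoly_add_div (j : ℕ) (x w : ℂ) :
    bernoulliPoly (j + 1) (x + w) / (j + 1) = x ^ (j + 1) / (j + 1) +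
      ∑ r ∈ Finset.range (j + 1), (j.choose r : ℂ) * x ^ (j - r) *
        (bernoulliPoly (r + 1) w / (r + 1)) := by
  rw [add_comm x, bernoulliPoly_add, ← Finset.sum_flip, Finset.sum_range_succ', add_div,
    Finset.sum_div, add_comm]
  congr 1
  · simp [bernoulliPoly]
  · refine Finset.sum_congr rfl fun r hr => ?_
    have hrj : r + 1 ≤ j + 1 := Finset.mem_range.mp hr
    rw [Nat.choose_symm hrj, Nat.sub_sub_self hrj, Nat.add_sub_add_right]
    linear_combination (-(x ^ (j - r) * bernoulliPoly (r + 1) w)) * choose_div_succ (K := ℂ) j r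

theorem isPolynomialOfDegreeLE_P (j : ℕ) : IsPolynomialOfDegreeLE (j + 1) (P j) :=
  .sum fun _ _ => (IsPolynomialOfDegreeLE.pow (Nat.sub_le _ _)).const_mul _

theorem isPolynomialOfDegreeLE_Q (j : ℕ) : IsPolynomialOfDegreeLE (j + 1) (Q j) := by
  refine (((isPolynomialOfDegreeLE_P j).comp_add_const 1).sub (.sum fun r hr => ?_)).add
    (.const_mul (.sum fun r hr => ?_) _)
  · exact ((IsPolynomialOfDegreeLE.pow (Finset.mem_range.mp hr).le).const_mul _).mul_const _
  · have hr : r ≤ j + 1 := (Finset.mem_Icc.mp hr).2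
    refine (((isPolynomialOfDegreeLE_bernoulliPoly (j + 1 - r)).const_mul _).mul (e := r)
      (.sum fun l hl => ?_)).mono (Nat.sub_add_cancel hr).le
    simp only [div_eq_mul_inv]
    exact ((IsPolynomialOfDegreeLE.pow (Finset.mem_Icc.mp hl).2).const_mul _).mul_const _

/-! ### The derivative of the Hurwitz zeta function at `-j` -/

theorem C_add_X_pow {R : Type*} [CommSemiring R] (x : R) (j : ℕ) :
    (Polynomial.C x + Polynomial.X : R[X]) ^ j =
      ∑ r ∈ Finset.range (j + 1), Polynomial.monomial r ((j.choose r : R) * x ^ (j - r)) := by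
  rw [add_comm, add_pow]
  refine Finset.sum_congr rfl fun r _ => ?_
  rw [← Polynomial.C_mul_X_pow_eq_monomial]
  simp only [map_mul, map_pow, map_natCast]
  ring

theorem logResidue_C_add_X_pow (x : ℂ) (j : ℕ) :
    logResidue x ((Polynomial.C x + Polynomial.X) ^ j) = x ^ (j + 1) / (j + 1) := by
  have hterm : ∀ r ∈ Finset.range (j + 1), logResidue x (Polynomial.monomial r
      ((j.choose r : ℂ) * x ^ (j - r))) =
      -(x ^ (j + 1) / (j + 1)) * ((-1) ^ (r + 1) * (j + 1).choose (r + 1)) := fun r hr => by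
    have hpow : x ^ (j + 1) = x ^ (j - r) * x ^ (r + 1) := by
      rw [← pow_add]
      congr 1
      grind
    rw [logResidue_monomial, hpow, pow_succ (-1 : ℂ) r]
    linear_combination x ^ (j - r) * x ^ (r + 1) * (-1) ^ r * choose_div_succ (K := ℂ) j r
  have halt : ∑ r ∈ Finset.range (j + 1), ((-1 : ℂ) ^ (r + 1) * (j + 1).choose (r + 1)) = -1 := by
    have hsum := congrArg (Int.cast : ℤ → ℂ)
      (Int.alternating_sum_range_choose_of_ne j.succ_ne_zero)
    rw [Finset.sum_range_succ', Nat.choose_zero_right] at hsum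
    push_cast at hsum
    linear_combination hsum
  rw [C_add_X_pow, map_sum, Finset.sum_congr rfl hterm, ← Finset.mul_sum, halt, mul_neg_one,
    neg_neg]

/-- `k ↦ B_{j+1}(x + k) / (j + 1)` as a polynomial in `k`. -/
noncomputable def bernoulliShift (j : ℕ) (x : ℂ) : ℂ[X] :=
  ∑ r ∈ Finset.range (j + 2), Polynomial.monomial r
    (((j + 1).choose r : ℂ) * bernoulliPoly (j + 1 - r) x / (j + 1))

theorem eval_bernoulliShift (j : ℕ) (x w : ℂ) :
    (bernoulliShift j x).eval w = bernoulliPoly (j + 1) (x + w) / (j + 1) := by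
  rw [bernoulliPoly_add, bernoulliShift, Polynomial.eval_finsetSum, Finset.sum_div]
  refine Finset.sum_congr rfl fun r _ => ?_
  rw [Polynomial.eval_monomial]
  ring

theorem eval_one_logPolynomialPart_monomial (x : ℂ) (r : ℕ) (c : ℂ) :
    (logPolynomialPart x (Polynomial.monomial r c)).eval 1 =
      c * ∑ l ∈ Finset.Icc 1 r, (-1) ^ (l - 1) * x ^ l / l := by
  rw [logPolynomialPart_monomial, Polynomial.eval_smul, Polynomial.eval_finsetSum, smul_eq_mul,
    ← Finset.Ico_succ_right_eq_Icc, Finset.sum_Ico_eq_sum_range]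
  congr 1
  refine Finset.sum_congr rfl fun i _ => ?_
  rw [Polynomial.eval_monomial, one_pow, mul_one, add_comm 1 i, Nat.add_sub_cancel,
    Nat.cast_add_one]

/-- The polynomial in `m` that collects the polynomial terms in the large `m` expansion of
`ζ'(-j, x + m) - ∑ r, binom(j, r) x ^ (j - r) ζ'(-r, m)`; its value at `m = 1` is `Q j x`. -/
noncomputable def shiftedQ (j : ℕ) (x m : ℂ) : ℂ :=
  (logPolynomialPart x (bernoulliShift j x)).eval m + P j (m + x) -
    ∑ r ∈ Finset.range (j + 1), (j.choose r : ℂ) * x ^ (j - r) * P r m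

theorem shiftedQ_one (j : ℕ) (x : ℂ) : shiftedQ j x 1 = Q j x := by
  have hflip : ∑ r ∈ Finset.range (j + 1), (j.choose r : ℂ) * x ^ (j - r) * P r 1 =
      ∑ r ∈ Finset.range (j + 1), (j.choose r : ℂ) * x ^ r * P (j - r) 1 := by
    rw [← Finset.sum_flip]
    refine Finset.sum_congr rfl fun r hr => ?_
    have hrj : r ≤ j := Finset.mem_range_succ_iff.mp hr
    rw [Nat.choose_symm hrj, Nat.sub_sub_self hrj]
  have hlog : (logPolynomialPart x (bernoulliShift j x)).eval 1 =
      1 / ((j : ℂ) + 1) * ∑ r ∈ Finset.Icc 1 (j + 1),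
        ((j + 1).choose r : ℂ) * bernoulliPoly (j + 1 - r) x *
          ∑ l ∈ Finset.Icc 1 r, (-1 : ℂ) ^ (l - 1) * x ^ l / (l : ℂ) := by
    rw [bernoulliShift, map_sum, Polynomial.eval_finsetSum, Finset.range_eq_Ico,
      Finset.sum_eq_sum_Ico_succ_bot (Nat.succ_pos _), ← Finset.Ico_succ_right_eq_Icc,
      Finset.mul_sum]
    simp only [eval_one_logPolynomialPart_monomial, Finset.Icc_eq_empty_of_lt one_pos,
      Finset.sum_empty, mul_zero, zero_add]
    refine Finset.sum_congr rfl fun r _ => ?_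
    ring
  rw [shiftedQ, Q, hflip, hlog, add_comm x]
  ring

theorem isPolynomialOfDegreeLE_shiftedQ (j : ℕ) (x : ℂ) : IsPolynomialOfDegreeLE
    (max (logPolynomialPart x (bernoulliShift j x)).natDegree (j + 1)) (shiftedQ j x) := by
  refine ((IsPolynomialOfDegreeLE.eval (le_max_left _ _)).add
    (((isPolynomialOfDegreeLE_P j).comp_add_const x).mono (le_max_right _ _))).sub
      (.sum fun r hr => ((isPolynomialOfDegreeLE_P r).const_mul _).mono ?_)
  exact le_max_of_le_right (Finset.mem_range.mp hr)

theorem log_add_one_add_natCast {x : ℝ} (hx : -1 < x) (k : ℕ) : (Real.log (x + 1 + k) : ℂ) =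
    Real.log (1 + k) + Complex.log (1 + (x : ℂ) / ((k : ℂ) + 1)) := by
  have hk : 0 < (1 : ℝ) + k := by positivity
  have hxk : 0 < 1 + x / (1 + k) := by
    rw [one_add_div hk.ne']
    exact div_pos (by linarith [k.cast_nonneg (α := ℝ)]) hk
  have hcast : 1 + (x : ℂ) / ((k : ℂ) + 1) = ((1 + x / (1 + k) : ℝ) : ℂ) := by
    push_cast
    rw [add_comm (k : ℂ)]
  rw [hcast, ← Complex.ofReal_log hxk.le, ← Complex.ofReal_add, ← Real.log_mul hk.ne' hxk.ne',
    mul_add, mul_one, mul_div_cancel₀ _ hk.ne', add_assoc x, add_comm x]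

theorem hurwitzDerivApprox_add_one (j N : ℕ) {x : ℝ} (hx : -1 < x) :
    hurwitzDerivApprox j N (x + 1) =
      (bernoulliShift j x).eval ((N : ℂ) + 1) *
          (Real.log (1 + N) + Complex.log (1 + (x : ℂ) / ((N : ℂ) + 1))) +
        P j ((N : ℂ) + 1 + x) -
        ∑ k ∈ Finset.range N, ((Polynomial.C (x : ℂ) + Polynomial.X) ^ j).eval ((k : ℂ) + 1) *
          (Real.log (1 + k) + Complex.log (1 + (x : ℂ) / ((k : ℂ) + 1))) := by
  have hcast : ∀ k : ℕ, ((x + 1 + k : ℝ) : ℂ) = x + ((k : ℂ) + 1) := fun k => by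
    push_cast
    ring
  simp only [hurwitzDerivApprox, log_add_one_add_natCast hx, hcast, eval_bernoulliShift,
    Polynomial.eval_pow, Polynomial.eval_add, Polynomial.eval_C, Polynomial.eval_X,
    add_comm ((N : ℂ) + 1) (x : ℂ)]

theorem sum_choose_mul_hurwitzDerivApprox_one (j N : ℕ) (x : ℂ) :
    ∑ r ∈ Finset.range (j + 1), (j.choose r : ℂ) * x ^ (j - r) * hurwitzDerivApprox r N 1 =
      ((bernoulliShift j x).eval ((N : ℂ) + 1) - x ^ (j + 1) / (j + 1)) * Real.log (1 + N) +
        ∑ r ∈ Finset.range (j + 1), (j.choose r : ℂ) * x ^ (j - r) * P r ((N : ℂ) + 1) -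
        ∑ k ∈ Finset.range N, ((Polynomial.C x + Polynomial.X) ^ j).eval ((k : ℂ) + 1) *
          (Real.log (1 + k) : ℂ) := by
  have hcast : ∀ k : ℕ, ((1 + k : ℝ) : ℂ) = (k : ℂ) + 1 := fun k => by
    push_cast
    ring
  have hpow : ∀ w : ℂ, ((Polynomial.C x + Polynomial.X) ^ j).eval w =
      ∑ r ∈ Finset.range (j + 1), (j.choose r : ℂ) * x ^ (j - r) * w ^ r := fun w => by
    simp only [C_add_X_pow, Polynomial.eval_finsetSum, Polynomial.eval_monomial]
  simp only [hurwitzDerivApprox, hcast, hpow, eval_bernoulliShift, bernoulliPoly_add_div,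
    add_sub_cancel_left, Finset.sum_mul]
  rw [Finset.sum_comm, ← Finset.sum_add_distrib, ← Finset.sum_sub_distrib]
  refine Finset.sum_congr rfl fun r _ => ?_
  rw [mul_sub, Finset.mul_sum]
  simp only [mul_assoc]
  ring

theorem hurwitzDerivApprox_add_one_sub_sum (j N : ℕ) {x : ℝ} (hx : -1 < x) :
    hurwitzDerivApprox j N (x + 1) -
      ∑ r ∈ Finset.range (j + 1), (j.choose r : ℂ) * (x : ℂ) ^ (j - r) * hurwitzDerivApprox r N 1 =
    (x : ℂ) ^ (j + 1) / (j + 1) * (Real.log (1 + N) - ∑ k ∈ Finset.range N, ((k : ℂ) + 1)⁻¹) -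
    ∑ k ∈ Finset.range N, logRemainder x ((k : ℂ) + 1) ((Polynomial.C (x : ℂ) + Polynomial.X) ^ j) +
    (Complex.log (1 + x / ((N : ℂ) + 1)) * (bernoulliShift j x).eval ((N : ℂ) + 1) -
      (logPolynomialPart x (bernoulliShift j x)).eval ((N : ℂ) + 1)) +
    (shiftedQ j x ((N : ℂ) + 1) - ∑ k ∈ Finset.range N,
      (logPolynomialPart x ((Polynomial.C (x : ℂ) + Polynomial.X) ^ j)).eval ((k : ℂ) + 1)) := by
  rw [hurwitzDerivApprox_add_one j N hx, sum_choose_mul_hurwitzDerivApprox_one, shiftedQ]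
  simp only [logRemainder_apply, logPrincipalPart_apply, logResidue_C_add_X_pow, mul_add,
    Finset.sum_add_distrib, Finset.sum_sub_distrib, ← Finset.sum_mul]
  simp only [mul_comm (Complex.log _)]
  ring

theorem tendsto_log_one_add_sub_harmonic :
    Tendsto (fun N : ℕ => (Real.log (1 + N) : ℂ) - ∑ k ∈ Finset.range N, ((k : ℂ) + 1)⁻¹)
      atTop (𝓝 (-Real.eulerMascheroniConstant)) := by
  rw [← Complex.ofReal_neg]
  refine Real.tendsto_harmonic_sub_log_add_one.neg.ofReal.congr fun N => ?_
  simp only [harmonic, add_comm (1 : ℝ)]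
  push_cast
  ring

theorem tendsto_hurwitzDerivApprox_add_one (j : ℕ) {x : ℝ} (hx : -1 < x) :
    Tendsto (fun N => hurwitzDerivApprox j N (x + 1)) atTop
      (𝓝 (Q j x + ∑ r ∈ Finset.range (j + 1), (j.choose r : ℂ) * (x : ℂ) ^ (j - r) *
          deriv riemannZeta (-r) - Real.eulerMascheroniConstant * ((x : ℂ) ^ (j + 1) / (j + 1)) -
        ∑' k : ℕ,
          logRemainder x ((k : ℂ) + 1) ((Polynomial.C (x : ℂ) + Polynomial.X) ^ j))) := by
  set q : ℂ[X] := (Polynomial.C (x : ℂ) + Polynomial.X) ^ j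
  obtain ⟨Z, hZ⟩ := exists_tendsto_hurwitzDerivApprox j (y := x + 1) (by linarith)
  have hzeta : Tendsto (fun N => ∑ r ∈ Finset.range (j + 1),
      (j.choose r : ℂ) * (x : ℂ) ^ (j - r) * hurwitzDerivApprox r N 1) atTop
      (𝓝 (∑ r ∈ Finset.range (j + 1), (j.choose r : ℂ) * (x : ℂ) ^ (j - r) *
          deriv riemannZeta (-r))) :=
    tendsto_finsetSum _ fun r _ => (tendsto_hurwitzDerivApprox_one r).const_mul _
  have hgamma := tendsto_log_one_add_sub_harmonic.const_mul ((x : ℂ) ^ (j + 1) / (j + 1))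
  have hseries := (summable_logRemainder q x).hasSum.tendsto_sum_nat
  have hbernoulli := tendsto_eval_mul_log_sub_logPolynomialPart (bernoulliShift j x) x
  have hpoly : Tendsto (fun N : ℕ => shiftedQ j x ((N : ℂ) + 1) -
      ∑ k ∈ Finset.range N, (logPolynomialPart x q).eval ((k : ℂ) + 1)) atTop (𝓝 _) :=
    ((((hZ.sub hzeta).sub hgamma).add hseries).sub hbernoulli).congr fun N => by
      rw [hurwitzDerivApprox_add_one_sub_sum j N hx]
      ring
  have hlim := IsPolynomialOfDegreeLE.eq_of_tendsto_sub_sum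
    ((isPolynomialOfDegreeLE_shiftedQ j x).mono (le_max_left _ _))
    ((IsPolynomialOfDegreeLE.eval le_rfl).mono (le_max_right _ _)) hpoly
  rw [shiftedQ_one] at hlim
  convert hZ using 2
  linear_combination -hlim

/-! ### The binomial polynomials -/

/-- The polynomial `u ↦ binom(z - u, m)`. -/
noncomputable def binomPoly (m : ℕ) (z : ℂ) : ℂ[X] :=
  Ring.choose (Polynomial.C z - Polynomial.X : ℂ[X]) m

theorem eval_binomPoly (m : ℕ) (z w : ℂ) : (binomPoly m z).eval w = Ring.choose (z - w) m := by
  rw [binomPoly, ← Polynomial.coe_evalRingHom, Ring.map_choose, map_sub,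
    Polynomial.coe_evalRingHom, Polynomial.eval_C, Polynomial.eval_X]

theorem taylor_binomPoly (m : ℕ) (z w : ℂ) :
    Polynomial.taylor w (binomPoly m z) = binomPoly m (z - w) := by
  have hmap := Ring.map_choose (Polynomial.compRingHom (Polynomial.X + Polynomial.C w))
    (Polynomial.C z - Polynomial.X : ℂ[X]) m
  rw [Polynomial.coe_compRingHom_apply, Polynomial.coe_compRingHom_apply] at hmap
  rw [Polynomial.taylor_apply, binomPoly, hmap, binomPoly]
  congr 1
  simp only [Polynomial.sub_comp, Polynomial.C_comp, Polynomial.X_comp, map_sub]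
  ring

theorem binomPoly_succ_add_one (m : ℕ) (z : ℂ) :
    binomPoly (m + 1) (z + 1) = binomPoly (m + 1) z + binomPoly m z := by
  rw [binomPoly, map_add, map_one, add_sub_right_comm, Ring.choose_succ_succ, add_comm]
  rfl

theorem binomPoly_zero_eq_sum_monomial (m : ℕ) : binomPoly m 0 = ∑ r ∈ Finset.range (m + 1),
    Polynomial.monomial r ((m.factorial : ℂ)⁻¹ * (stirlingS m r * (-1) ^ r)) := by
  have hfac : (m.factorial : ℂ) ≠ 0 := Nat.cast_ne_zero.mpr m.factorial_ne_zero
  have hdesc := Ring.descPochhammer_eq_factorial_smul_choose (-Polynomial.X : ℂ[X]) m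
  rw [← Polynomial.aeval_eq_smeval, Polynomial.aeval_eq_sum_range, descPochhammer_natDegree,
    ← Nat.cast_smul_eq_nsmul ℂ] at hdesc
  rw [binomPoly, map_zero, zero_sub, ← inv_smul_smul₀ hfac (Ring.choose _ m), ← hdesc,
    Finset.smul_sum]
  refine Finset.sum_congr rfl fun r _ => ?_
  rw [stirlingS, neg_pow, ← Polynomial.C_mul_X_pow_eq_monomial, Polynomial.smul_eq_C_mul,
    zsmul_eq_mul]
  simp only [map_mul, map_pow, map_neg, map_one, map_intCast]
  ring

theorem natDegree_binomPoly_le (m : ℕ) (z : ℂ) : (binomPoly m z).natDegree ≤ m := by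
  rw [← Polynomial.natDegree_taylor _ z, taylor_binomPoly, sub_self, binomPoly_zero_eq_sum_monomial]
  exact Polynomial.natDegree_sum_le_of_forall_le _ _ fun r hr =>
    (Polynomial.natDegree_monomial_le _).trans (Finset.mem_range_succ_iff.mp hr)

theorem isPolynomialOfDegreeLE_coeff_binomPoly (m j : ℕ) :
    IsPolynomialOfDegreeLE (m - j) fun z => (binomPoly m z).coeff j := by
  refine ⟨(Polynomial.hasseDeriv j (binomPoly m 0)).comp (-Polynomial.X), ?_, fun z => ?_⟩
  · rw [Polynomial.natDegree_comp, Polynomial.natDegree_neg, Polynomial.natDegree_X, mul_one]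
    exact (Polynomial.natDegree_hasseDeriv_le _ _).trans
      (Nat.sub_le_sub_right (natDegree_binomPoly_le m 0) j)
  · rw [Polynomial.eval_comp, Polynomial.eval_neg, Polynomial.eval_X, ← Polynomial.taylor_coeff,
      taylor_binomPoly, zero_sub, neg_neg]

theorem coeff_binomPoly_self (m : ℕ) (z : ℂ) :
    (binomPoly m z).coeff m = (binomPoly m 0).coeff m := by
  obtain ⟨p, hp, hpoly⟩ := isPolynomialOfDegreeLE_coeff_binomPoly m m
  rw [Nat.sub_self, Nat.le_zero, Polynomial.natDegree_eq_zero] at hp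
  obtain ⟨c, rfl⟩ := hp
  exact ((hpoly z).trans Polynomial.eval_C).trans ((hpoly 0).trans Polynomial.eval_C).symm

theorem map_binomPoly {M : Type*} [AddCommMonoid M] [Module ℂ M] (L : ℂ[X] →ₗ[ℂ] M) (m : ℕ)
    (z : ℂ) : L (binomPoly m z) =
      ∑ j ∈ Finset.range (m + 1), (binomPoly m z).coeff j • L (Polynomial.X ^ j) := by
  conv_lhs => rw [Polynomial.as_sum_range_C_mul_X_pow' _
    (Nat.lt_succ_of_le (natDegree_binomPoly_le m z))]
  simp only [← Polynomial.smul_eq_C_mul, map_sum, map_smul]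

theorem map_binomPoly_zero {M : Type*} [AddCommMonoid M] [Module ℂ M] (L : ℂ[X] →ₗ[ℂ] M) (m : ℕ)
    (z : ℂ) : L (binomPoly m 0) = ∑ j ∈ Finset.range (m + 1),
      (binomPoly m z).coeff j • L ((Polynomial.C z + Polynomial.X) ^ j) := by
  rw [← sub_self z, ← taylor_binomPoly, ← LinearMap.comp_apply, map_binomPoly]
  simp only [LinearMap.comp_apply, Polynomial.taylor_X_pow, add_comm]

theorem iteratedDeriv_polynomial_eval {𝕜 : Type*} [NontriviallyNormedField 𝕜] (p : 𝕜[X]) (r : ℕ) :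
    iteratedDeriv r (fun u => p.eval u) = fun u => (Polynomial.derivative^[r] p).eval u := by
  induction r with
  | zero => exact iteratedDeriv_zero
  | succ r ih =>
    funext u
    rw [iteratedDeriv_succ, ih, Function.iterate_succ_apply', Polynomial.deriv]

theorem iteratedDeriv_choose_sub (m r : ℕ) (z w : ℂ) :
    1 / (r.factorial : ℂ) * iteratedDeriv r (fun u : ℂ => Ring.choose (z - u) m) w =
      (binomPoly m (z - w)).coeff r := by
  have hfac : (r.factorial : ℂ) ≠ 0 := Nat.cast_ne_zero.mpr r.factorial_ne_zero
  simp only [← eval_binomPoly, iteratedDeriv_polynomial_eval]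
  rw [← taylor_binomPoly, Polynomial.taylor_coeff, ← Polynomial.factorial_smul_hasseDeriv,
    LinearMap.smul_apply, Polynomial.eval_smul, nsmul_eq_mul, one_div, inv_mul_cancel_left₀ hfac]

theorem integral_choose_sub_mul (m : ℕ) (z : ℂ) :
    ∫ t in (0 : ℝ)..1, Ring.choose (z - (t : ℂ) * z) m * z = logResidue z (binomPoly m 0) := by
  have hexpand : ∀ t : ℝ, Ring.choose (z - (t : ℂ) * z) m * z =
      ∑ j ∈ Finset.range (m + 1), (binomPoly m z).coeff j * z ^ (j + 1) * ((t ^ j : ℝ) : ℂ) := by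
    intro t
    rw [← eval_binomPoly, Polynomial.eval_eq_sum_range' (Nat.lt_succ_of_le
      (natDegree_binomPoly_le m z)), Finset.sum_mul]
    refine Finset.sum_congr rfl fun j _ => ?_
    push_cast
    ring
  simp only [hexpand]
  rw [intervalIntegral.integral_finsetSum
    fun j _ => (by fun_prop : Continuous _).intervalIntegrable _ _, map_binomPoly_zero _ m z]
  refine Finset.sum_congr rfl fun j _ => ?_
  rw [intervalIntegral.integral_const_mul, intervalIntegral.integral_ofReal, integral_pow,
    logResidue_C_add_X_pow, smul_eq_mul]
  push_cast
  rw [one_pow, zero_pow j.succ_ne_zero]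
  ring

theorem pow_mul_logTaylor (r : ℕ) (z : ℂ) {k : ℂ} (hk : k ≠ 0) :
    k ^ r * Complex.logTaylor (r + 2) (z / k) = ∑ a ∈ Finset.range (r + 1),
      (-1) ^ (r + a) * (z ^ (r + 1 - a) / ((r + 1 - a : ℕ) : ℂ)) * k ^ ((a : ℤ) - 1) := by
  rw [Complex.logTaylor, Finset.sum_range_succ', ← Finset.sum_flip]
  simp only [Nat.cast_zero, div_zero, add_zero, Finset.mul_sum]
  refine Finset.sum_congr rfl fun a ha => ?_
  obtain ⟨d, rfl⟩ := Nat.exists_eq_add_of_le (Finset.mem_range_succ_iff.mp ha)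
  have hd : ((d + 1 : ℕ) : ℂ) ≠ 0 := Nat.cast_ne_zero.mpr d.succ_ne_zero
  have hsign : (-1 : ℂ) ^ (a + d + a) = (-1) ^ (d + 1 + 1) := by
    rw [add_right_comm, pow_add, Even.neg_one_pow ⟨a, rfl⟩, one_mul, pow_add, pow_add]
    ring
  rw [hsign, Nat.add_sub_cancel_left, add_assoc a d 1, Nat.add_sub_cancel_left,
    zpow_sub_one₀ hk, zpow_natCast, div_pow, pow_add k a d]
  field_simp
  ring

theorem Phi_succ (m : ℕ) (z : ℂ) {k : ℕ} (hk : k ≠ 0) :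
    Phi (m + 1) z k = logPrincipalPart z k (binomPoly m 0) := by
  have hk : (k : ℂ) ≠ 0 := Nat.cast_ne_zero.mpr hk
  rw [binomPoly_zero_eq_sum_monomial, map_sum, Phi, Nat.add_sub_cancel]
  simp only [logPrincipalPart_monomial z hk, pow_mul_logTaylor _ z hk, Finset.sum_mul,
    Finset.mul_sum, Finset.range_eq_Ico]
  rw [Finset.sum_Ico_Ico_comm]
  refine Finset.sum_congr rfl fun r _ => Finset.sum_congr rfl fun a _ => ?_
  have hsign : (-1 : ℂ) ^ r * (-1) ^ (r + a) = (-1) ^ a := by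
    rw [pow_add, ← mul_assoc, ← pow_add, Even.neg_one_pow ⟨r, rfl⟩, one_mul]
  rw [← hsign]
  ring

/-! ### The logarithm of the multiple gamma functions -/

/-- The linear functional `X ^ j ↦ ζ'(-j, y)`, where `ζ'(s, y)` is the derivative in `s` of the
Hurwitz zeta function. Each value is encoded as the limit of its Euler–Maclaurin approximations,
which exists for `y > 0`. -/
noncomputable def hurwitzZetaDeriv (y : ℝ) : ℂ[X] →ₗ[ℂ] ℂ :=
  Polynomial.lsum fun j => LinearMap.toSpanSingleton ℂ ℂ
    (limUnder atTop fun N => hurwitzDerivApprox j N y)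

theorem hurwitzZetaDeriv_X_pow (y : ℝ) (j : ℕ) : hurwitzZetaDeriv y (Polynomial.X ^ j) =
    limUnder atTop fun N => hurwitzDerivApprox j N y := by
  rw [hurwitzZetaDeriv, Polynomial.lsum_apply, ← Polynomial.monomial_one_right_eq_X_pow,
    Polynomial.sum_monomial_index _ _ (by simp), LinearMap.toSpanSingleton_apply, one_smul]

theorem tendsto_hurwitzDerivApprox (j : ℕ) {y : ℝ} (hy : 0 < y) :
    Tendsto (fun N => hurwitzDerivApprox j N y) atTop
      (𝓝 (hurwitzZetaDeriv y (Polynomial.X ^ j))) := by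
  rw [hurwitzZetaDeriv_X_pow]
  exact tendsto_nhds_limUnder (exists_tendsto_hurwitzDerivApprox j hy)

theorem hurwitzZetaDeriv_one_X_pow (j : ℕ) :
    hurwitzZetaDeriv 1 (Polynomial.X ^ j) = deriv riemannZeta (-j) :=
  tendsto_nhds_unique (tendsto_hurwitzDerivApprox j one_pos) (tendsto_hurwitzDerivApprox_one j)

theorem hurwitzZetaDeriv_one_C_add_X_pow (x : ℂ) (j : ℕ) :
    hurwitzZetaDeriv 1 ((Polynomial.C x + Polynomial.X) ^ j) =
      ∑ r ∈ Finset.range (j + 1), (j.choose r : ℂ) * x ^ (j - r) * deriv riemannZeta (-r) := by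
  simp only [C_add_X_pow, map_sum, ← hurwitzZetaDeriv_one_X_pow, ← smul_eq_mul (_ * _), ← map_smul,
    Polynomial.smul_X_eq_monomial]

theorem hurwitzZetaDeriv_add_one_X_pow (j : ℕ) {x : ℝ} (hx : -1 < x) :
    hurwitzZetaDeriv (x + 1) (Polynomial.X ^ j) =
      Q j x + hurwitzZetaDeriv 1 ((Polynomial.C (x : ℂ) + Polynomial.X) ^ j) -
        Real.eulerMascheroniConstant * logResidue x ((Polynomial.C (x : ℂ) + Polynomial.X) ^ j) -
        ∑' k : ℕ, logRemainder x ((k : ℂ) + 1) ((Polynomial.C (x : ℂ) + Polynomial.X) ^ j) := by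
  rw [hurwitzZetaDeriv_one_C_add_X_pow, logResidue_C_add_X_pow]
  exact tendsto_nhds_unique (tendsto_hurwitzDerivApprox j (by linarith))
    (tendsto_hurwitzDerivApprox_add_one j hx)

theorem hurwitzZetaDeriv_add_one (p : ℂ[X]) {y : ℝ} (hy : 0 < y) :
    hurwitzZetaDeriv (y + 1) p = hurwitzZetaDeriv y p + p.eval (y : ℂ) * Real.log y := by
  induction p using Polynomial.induction_on' with
  | add p q hp hq => rw [map_add, map_add, hp, hq, Polynomial.eval_add]; ring
  | monomial j a =>
    rw [← Polynomial.smul_X_eq_monomial, map_smul, map_smul, Polynomial.eval_smul, smul_eq_mul,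
      smul_eq_mul, smul_eq_mul, mul_assoc, ← mul_add, Polynomial.eval_pow, Polynomial.eval_X]
    congr 1
    refine tendsto_nhds_unique (tendsto_hurwitzDerivApprox j (add_pos hy one_pos))
      ((((tendsto_hurwitzDerivApprox j hy).comp (tendsto_add_atTop_nat 1)).add_const _).congr
        fun N => ?_)
    have hshift : ∀ k : ℕ, y + (k + 1 : ℕ) = y + 1 + k := fun k => by
      push_cast
      ring
    simp only [Function.comp_apply, hurwitzDerivApprox, Finset.sum_range_succ', hshift,
      Nat.cast_zero, add_zero]
    ring

theorem F_succ (m : ℕ) (z : ℂ) : F (m + 1) z =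
    ∑ j ∈ Finset.range (m + 1), (binomPoly m z).coeff j * Q j z +
      (hurwitzZetaDeriv 1 (binomPoly m 0) - hurwitzZetaDeriv 1 (binomPoly m z)) -
      Real.eulerMascheroniConstant * logResidue z (binomPoly m 0) := by
  have hzeta : ∑ r ∈ Finset.range m,
      (1 / (r.factorial : ℂ) * iteratedDeriv r (fun u : ℂ => Ring.choose (z - u) m) z -
        1 / (r.factorial : ℂ) * iteratedDeriv r (fun u : ℂ => Ring.choose (z - u) m) 0) *
        deriv riemannZeta (-(r : ℂ)) =
      hurwitzZetaDeriv 1 (binomPoly m 0) - hurwitzZetaDeriv 1 (binomPoly m z) := by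
    rw [map_binomPoly _ m 0, map_binomPoly _ m z, ← Finset.sum_sub_distrib, Finset.sum_range_succ,
      coeff_binomPoly_self m z, sub_self, add_zero]
    simp only [iteratedDeriv_choose_sub, sub_self, sub_zero, hurwitzZetaDeriv_one_X_pow,
      smul_eq_mul, sub_mul]
  rw [F, Nat.add_sub_cancel, hzeta, integral_choose_sub_mul, mul_comm (logResidue _ _)]
  rfl

theorem isPolynomialOfDegreeLE_F (m : ℕ) : IsPolynomialOfDegreeLE (m + 1) (F (m + 1)) := by
  have hcoeff : ∀ j ∈ Finset.range (m + 1), ∀ {f}, IsPolynomialOfDegreeLE (j + 1) f →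
      IsPolynomialOfDegreeLE (m + 1) fun z => (binomPoly m z).coeff j * f z := fun j hj _ hf =>
    ((isPolynomialOfDegreeLE_coeff_binomPoly m j).mul hf).mono (by grind)
  have hzeta : IsPolynomialOfDegreeLE (m + 1) fun z => hurwitzZetaDeriv 1 (binomPoly m z) := by
    rw [funext (map_binomPoly (hurwitzZetaDeriv 1) m)]
    exact .sum fun j hj => hcoeff j hj (.const _)
  have hresidue : IsPolynomialOfDegreeLE (m + 1) fun z => logResidue z (binomPoly m 0) := by
    rw [funext fun z => map_binomPoly_zero (logResidue z) m z]
    refine .sum fun j hj => hcoeff j hj ?_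
    simp only [logResidue_C_add_X_pow, div_eq_mul_inv]
    exact (IsPolynomialOfDegreeLE.pow le_rfl).mul_const _
  rw [funext (F_succ m)]
  exact ((IsPolynomialOfDegreeLE.sum fun j hj => hcoeff j hj (isPolynomialOfDegreeLE_Q j)).add
    ((IsPolynomialOfDegreeLE.const _).sub hzeta)).sub (hresidue.const_mul _)

/-- The logarithm of the multiple gamma function `G_{m+1}` at `x + 1`, expressed through derivatives
of the Hurwitz zeta function. -/
noncomputable def logMultipleGamma (m : ℕ) (x : ℝ) : ℂ :=
  hurwitzZetaDeriv (x + 1) (binomPoly m x) - hurwitzZetaDeriv 1 (binomPoly m x)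

theorem logMultipleGamma_zero (m : ℕ) : logMultipleGamma m 0 = 0 := by
  rw [logMultipleGamma, zero_add, sub_self]

theorem logMultipleGamma_zero_add_one {x : ℝ} (hx : -1 < x) :
    logMultipleGamma 0 (x + 1) = logMultipleGamma 0 x + Real.log (x + 1) := by
  rw [logMultipleGamma, hurwitzZetaDeriv_add_one _ (neg_lt_iff_pos_add.mp hx), logMultipleGamma]
  simp only [binomPoly, Ring.choose_zero_right, Polynomial.eval_one]
  ring

theorem logMultipleGamma_succ_add_one (m : ℕ) {x : ℝ} (hx : -1 < x) :
    logMultipleGamma (m + 1) (x + 1) = logMultipleGamma (m + 1) x + logMultipleGamma m x := by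
  rw [logMultipleGamma, hurwitzZetaDeriv_add_one _ (neg_lt_iff_pos_add.mp hx), eval_binomPoly,
    sub_self, Ring.choose_zero_succ, zero_mul, add_zero, Complex.ofReal_add, Complex.ofReal_one,
    binomPoly_succ_add_one, map_add, map_add, logMultipleGamma, logMultipleGamma]
  ring

theorem logMultipleGamma_eq (m : ℕ) {x : ℝ} (hx : -1 < x) : logMultipleGamma m x =
    F (m + 1) x - ∑' k : ℕ, logRemainder x ((k : ℂ) + 1) (binomPoly m 0) := by
  have hseries : ∑' k : ℕ, logRemainder x ((k : ℂ) + 1) (binomPoly m 0) =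
      ∑ j ∈ Finset.range (m + 1), (binomPoly m x).coeff j *
        ∑' k : ℕ, logRemainder x ((k : ℂ) + 1) ((Polynomial.C (x : ℂ) + Polynomial.X) ^ j) := by
    simp only [map_binomPoly_zero _ m x, smul_eq_mul, ← tsum_mul_left]
    exact Summable.tsum_finsetSum fun j _ => (summable_logRemainder _ _).mul_left _
  rw [logMultipleGamma, F_succ, hseries, map_binomPoly (hurwitzZetaDeriv (x + 1)),
    map_binomPoly_zero (hurwitzZetaDeriv 1) m x, map_binomPoly_zero (logResidue x) m x]
  simp only [hurwitzZetaDeriv_add_one_X_pow _ hx, smul_eq_mul, mul_sub, mul_add,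
    Finset.sum_sub_distrib, Finset.sum_add_distrib, Finset.mul_sum]
  simp only [mul_left_comm]
  ring

/-! ### Realness on the real axis -/

theorem conj_coeff_binomPoly (m j : ℕ) (z : ℂ) :
    (starRingEnd ℂ) ((binomPoly m z).coeff j) = (binomPoly m ((starRingEnd ℂ) z)).coeff j := by
  rw [← Polynomial.coeff_map, ← Polynomial.coe_mapRingHom, binomPoly, Ring.map_choose, map_sub,
    Polynomial.coe_mapRingHom, Polynomial.map_C, Polynomial.map_X, binomPoly]

theorem conj_bernoulliPoly (n : ℕ) (z : ℂ) :
    (starRingEnd ℂ) (bernoulliPoly n z) = bernoulliPoly n ((starRingEnd ℂ) z) :=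
  (Polynomial.aeval_algHom_apply (starRingEnd ℂ).toRatAlgHom z _).symm

theorem conj_P (j : ℕ) (z : ℂ) : (starRingEnd ℂ) (P j z) = P j ((starRingEnd ℂ) z) := by
  simp only [P, map_sum, map_mul, map_div₀, map_pow, map_natCast, map_ratCast, Complex.conj_ofReal]

theorem conj_hurwitzDerivApprox (j N : ℕ) (y : ℝ) :
    (starRingEnd ℂ) (hurwitzDerivApprox j N y) = hurwitzDerivApprox j N y := by
  simp only [hurwitzDerivApprox, map_sub, map_add, map_mul, map_sum, map_div₀, map_pow, map_one,
    map_natCast, conj_bernoulliPoly, conj_P, Complex.conj_ofReal]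

theorem conj_hurwitzZetaDeriv_X_pow (j : ℕ) {y : ℝ} (hy : 0 < y) :
    (starRingEnd ℂ) (hurwitzZetaDeriv y (Polynomial.X ^ j)) =
      hurwitzZetaDeriv y (Polynomial.X ^ j) :=
  tendsto_nhds_unique (((Complex.continuous_conj.tendsto _).comp
    (tendsto_hurwitzDerivApprox j hy)).congr fun N => conj_hurwitzDerivApprox j N y)
    (tendsto_hurwitzDerivApprox j hy)

theorem logMultipleGamma_im (m : ℕ) {x : ℝ} (hx : -1 < x) : (logMultipleGamma m x).im = 0 := by
  rw [← Complex.conj_eq_iff_im, logMultipleGamma, map_binomPoly, map_binomPoly]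
  simp only [smul_eq_mul, map_sub, map_sum, map_mul, conj_coeff_binomPoly, Complex.conj_ofReal,
    conj_hurwitzZetaDeriv_X_pow _ (neg_lt_iff_pos_add.mp hx),
    conj_hurwitzZetaDeriv_X_pow _ one_pos]

/-! ### Derivatives of the logarithm -/

section IteratedDeriv

variable {E : Type*} [NormedAddCommGroup E] [NormedSpace ℂ E] [CompleteSpace E] {U : Set ℂ}

theorem differentiableOn_iteratedDeriv {f : ℂ → E} (hf : DifferentiableOn ℂ f U) (hU : IsOpen U)
    (n : ℕ) : DifferentiableOn ℂ (iteratedDeriv n f) U := by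
  induction n with
  | zero => rwa [iteratedDeriv_zero]
  | succ n ih =>
    rw [iteratedDeriv_succ]
    exact ih.deriv hU

theorem tendstoLocallyUniformlyOn_iteratedDeriv {ι : Type*} {l : Filter ι} {f : ι → ℂ → E}
    {g : ℂ → E} (h : TendstoLocallyUniformlyOn f g l U) (hf : ∀ i, DifferentiableOn ℂ (f i) U)
    (hU : IsOpen U) (n : ℕ) :
    TendstoLocallyUniformlyOn (fun i => iteratedDeriv n (f i)) (iteratedDeriv n g) l U := by
  induction n with
  | zero => simpa only [iteratedDeriv_zero] using h
  | succ n ih =>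
    simp only [iteratedDeriv_succ]
    exact ih.deriv (.of_forall fun i => differentiableOn_iteratedDeriv (hf i) hU n) hU

end IteratedDeriv

theorem iteratedDeriv_re_ofReal {f : ℂ → ℂ} {U : Set ℂ} (hf : DifferentiableOn ℂ f U)
    (hU : IsOpen U) (n : ℕ) {x : ℝ} (hx : (x : ℂ) ∈ U) :
    iteratedDeriv n (fun t : ℝ => (f t).re) x = (iteratedDeriv n f x).re := by
  induction n generalizing x with
  | zero => simp only [iteratedDeriv_zero]
  | succ n ih =>
    have hind : iteratedDeriv n (fun t : ℝ => (f t).re) =ᶠ[𝓝 x]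
        fun t => (iteratedDeriv n f t).re := by
      filter_upwards [(hU.preimage Complex.continuous_ofReal).mem_nhds hx] with t ht using ih ht
    rw [iteratedDeriv_succ, iteratedDeriv_succ, hind.deriv_eq]
    exact ((differentiableOn_iteratedDeriv hf hU n).differentiableAt
      (hU.mem_nhds hx)).hasDerivAt.real_of_complex.deriv

namespace IsPolynomialOfDegreeLE

variable {d : ℕ} {f : ℂ → ℂ}

theorem differentiable (hf : IsPolynomialOfDegreeLE d f) : Differentiable ℂ f := by
  obtain ⟨p, -, hfp⟩ := hf
  rw [funext hfp]
  exact p.differentiable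

theorem iteratedDeriv_eq_zero (hf : IsPolynomialOfDegreeLE d f) {n : ℕ} (hn : d < n) :
    iteratedDeriv n f = 0 := by
  obtain ⟨p, hp, hfp⟩ := hf
  rw [funext hfp, iteratedDeriv_polynomial_eval,
    Polynomial.iterate_derivative_eq_zero (hp.trans_lt hn)]
  exact funext fun _ => Polynomial.eval_zero

end IsPolynomialOfDegreeLE

theorem isPolynomialOfDegreeLE_logPrincipalPart (p : ℂ[X]) {k : ℂ} (hk : k ≠ 0) :
    IsPolynomialOfDegreeLE (p.natDegree + 1) fun z => logPrincipalPart z k p := by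
  have hsum : ∀ z, logPrincipalPart z k p = ∑ r ∈ Finset.range (p.natDegree + 1),
      p.coeff r * (k ^ r * Complex.logTaylor (r + 2) (z / k)) := fun z => by
    conv_lhs => rw [p.as_sum_range, map_sum]
    exact Finset.sum_congr rfl fun r _ => logPrincipalPart_monomial z hk r _
  rw [funext hsum]
  refine .sum fun r hr => .const_mul (.const_mul (.sum fun j hj => ?_) _) _
  simp only [div_eq_mul_inv, mul_pow]
  have hj_le : j ≤ p.natDegree + 1 := by grind
  exact (((IsPolynomialOfDegreeLE.pow hj_le).mul_const _).const_mul _).mul_const _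

/-- The half plane to the right of the first singularity `-1` of `G_n(z + 1)`. -/
def rightHalfPlane : Set ℂ := {z | -1 < z.re}

theorem isOpen_rightHalfPlane : IsOpen rightHalfPlane :=
  isOpen_lt continuous_const Complex.continuous_re

theorem one_add_div_mem_slitPlane {z : ℂ} (hz : z ∈ rightHalfPlane) (k : ℕ) :
    1 + z / ((k : ℂ) + 1) ∈ Complex.slitPlane := by
  have hk : (0 : ℝ) < (k + 1 : ℕ) := by positivity
  have hk_ge : (1 : ℝ) ≤ (k + 1 : ℕ) := by norm_cast; lia
  have hz_re : -1 < z.re := hz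
  left
  rw [← Nat.cast_add_one, Complex.add_re, Complex.one_re, Complex.div_natCast_re,
    ← neg_lt_iff_pos_add', lt_div_iff₀ hk]
  linarith

theorem hasDerivAt_log_one_add_div {z : ℂ} (hz : z ∈ rightHalfPlane) (k : ℕ) :
    HasDerivAt (fun z => Complex.log (1 + z / ((k : ℂ) + 1))) (z + (k + 1))⁻¹ z := by
  refine ((((hasDerivAt_id z).div_const _).const_add 1).clog
    (one_add_div_mem_slitPlane hz k)).congr_deriv ?_
  have hk : (k : ℂ) + 1 ≠ 0 := k.cast_add_one_ne_zero
  rw [id_def, one_add_div hk, div_div_div_cancel_right₀ hk, one_div, add_comm z]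

theorem iteratedDeriv_log_one_add_div (r k : ℕ) {z : ℂ} (hz : z ∈ rightHalfPlane) :
    iteratedDeriv (r + 1) (fun z => Complex.log (1 + z / ((k : ℂ) + 1))) z =
      (-1) ^ r * r.factorial / (z + (k + 1)) ^ (r + 1) := by
  have hderiv : deriv (fun z => Complex.log (1 + z / ((k : ℂ) + 1))) =ᶠ[𝓝 z]
      fun z => (z + (k + 1))⁻¹ := by
    filter_upwards [isOpen_rightHalfPlane.mem_nhds hz] with w hw
    exact (hasDerivAt_log_one_add_div hw k).deriv
  have hexp : (-1 - r : ℤ) = -(r + 1 : ℕ) := by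
    push_cast
    ring
  have hinv := congrFun (iter_deriv_inv_linear r (1 : ℂ) ((k : ℂ) + 1)) z
  simp only [one_mul, one_pow, mul_one, hexp, zpow_neg, zpow_natCast] at hinv
  rw [iteratedDeriv_succ', hderiv.iteratedDeriv_eq r, iteratedDeriv_eq_iterate, hinv,
    div_eq_mul_inv]

theorem differentiableOn_logRemainder (p : ℂ[X]) (k : ℕ) :
    DifferentiableOn ℂ (fun z => logRemainder z ((k : ℂ) + 1) p) rightHalfPlane := fun z hz => by
  simp only [logRemainder_apply]
  exact (((hasDerivAt_log_one_add_div hz k).differentiableAt.mul_const _).sub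
    ((isPolynomialOfDegreeLE_logPrincipalPart p k.cast_add_one_ne_zero).differentiable z)
    ).differentiableWithinAt

theorem iteratedDeriv_logRemainder {p : ℂ[X]} {r : ℕ} (hr : p.natDegree < r) (k : ℕ) {z : ℂ}
    (hz : z ∈ rightHalfPlane) :
    iteratedDeriv (r + 1) (fun z => logRemainder z ((k : ℂ) + 1) p) z =
      (-1) ^ r * r.factorial / (z + (k + 1)) ^ (r + 1) * p.eval ((k : ℂ) + 1) := by
  have hpoly := isPolynomialOfDegreeLE_logPrincipalPart p (k := (k : ℂ) + 1) k.cast_add_one_ne_zero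
  have hlog : DifferentiableOn ℂ (fun z => Complex.log (1 + z / ((k : ℂ) + 1))) rightHalfPlane :=
    fun z hz => (hasDerivAt_log_one_add_div hz k).differentiableAt.differentiableWithinAt
  simp only [logRemainder_apply]
  rw [iteratedDeriv_fun_sub
    (((hlog.mul_const _).contDiffOn isOpen_rightHalfPlane).contDiffAt
      (isOpen_rightHalfPlane.mem_nhds hz))
    hpoly.differentiable.contDiff.contDiffAt, hpoly.iteratedDeriv_eq_zero (by lia),
    iteratedDeriv_mul_const_field, iteratedDeriv_log_one_add_div r k hz, Pi.zero_apply, sub_zero]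

theorem tendstoLocallyUniformlyOn_sum_logRemainder (p : ℂ[X]) :
    TendstoLocallyUniformlyOn
      (fun N z => ∑ k ∈ Finset.range N, logRemainder z ((k : ℂ) + 1) p)
      (fun z => ∑' k : ℕ, logRemainder z ((k : ℂ) + 1) p) atTop Set.univ := by
  simpa only [Finset.sum_range_zero, zero_add, Finset.sum_range_succ_sub_sum] using
    tendstoLocallyUniformlyOn_of_summable_norm_sub
      (F := fun N z => ∑ k ∈ Finset.range N, logRemainder z ((k : ℂ) + 1) p) isOpen_univ
      fun K _ hK => by
        obtain ⟨R, hR⟩ := hK.isBounded.exists_norm_le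
        obtain ⟨C, hC⟩ := exists_eventually_norm_logRemainder_le p R
        refine ⟨_, summable_one_div_add_one_sq.mul_left C, hC.mono fun k hk z hz => ?_⟩
        rw [Finset.sum_range_succ_sub_sum]
        exact hk z (hR z hz)

theorem differentiableOn_tsum_logRemainder (p : ℂ[X]) :
    DifferentiableOn ℂ (fun z => ∑' k : ℕ, logRemainder z ((k : ℂ) + 1) p) rightHalfPlane :=
  ((tendstoLocallyUniformlyOn_sum_logRemainder p).mono (Set.subset_univ _)).differentiableOn
    (.of_forall fun _ => .fun_sum fun k _ => differentiableOn_logRemainder p k)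
    isOpen_rightHalfPlane

theorem tendsto_iteratedDeriv_sum_logRemainder (p : ℂ[X]) {r : ℕ} (hr : p.natDegree < r) {z : ℂ}
    (hz : z ∈ rightHalfPlane) :
    Tendsto (fun N => ∑ k ∈ Finset.range N,
      (-1) ^ r * r.factorial / (z + (k + 1)) ^ (r + 1) * p.eval ((k : ℂ) + 1)) atTop
      (𝓝 (iteratedDeriv (r + 1) (fun z => ∑' k : ℕ, logRemainder z ((k : ℂ) + 1) p) z)) := by
  refine ((tendstoLocallyUniformlyOn_iteratedDeriv
    ((tendstoLocallyUniformlyOn_sum_logRemainder p).mono (Set.subset_univ _))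
    (fun _ => .fun_sum fun k _ => differentiableOn_logRemainder p k)
    isOpen_rightHalfPlane (r + 1)).tendsto_at hz).congr fun N => ?_
  rw [iteratedDeriv_fun_sum fun k _ =>
    ((differentiableOn_logRemainder p k).contDiffOn isOpen_rightHalfPlane).contDiffAt
      (isOpen_rightHalfPlane.mem_nhds hz)]
  exact Finset.sum_congr rfl fun k _ => iteratedDeriv_logRemainder hr k hz

theorem eval_binomPoly_zero_intCast (m : ℕ) (k : ℤ) :
    (binomPoly m 0).eval (k : ℂ) = (Ring.choose (-k) m : ℤ) := by
  rw [eval_binomPoly, zero_sub, ← Int.cast_neg]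
  exact (Ring.map_choose (Int.castRingHom ℂ) (-k) m).symm

theorem eval_binomPoly_zero_add_one (m k : ℕ) :
    (binomPoly m 0).eval ((k : ℂ) + 1) = (-1) ^ m * (k + m).choose m := by
  have hshift : (k : ℂ) + 1 + m - 1 = (k + m : ℕ) := by
    push_cast
    ring
  rw [eval_binomPoly, zero_sub, Ring.choose_neg, hshift, Ring.choose_natCast, Int.negOnePow_def,
    zpow_natCast, Units.smul_def, zsmul_eq_mul]
  push_cast
  rfl

/-- The `k`-th term of a series whose sum is the `(m + 2)`-nd derivative of `log G_{m+1}(x + 1)`. -/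
noncomputable def logDerivTerm (m k : ℕ) (x : ℝ) : ℝ :=
  (m + 1).factorial * (k + m).choose m / (x + (k + 1)) ^ (m + 2)

theorem logDerivTerm_nonneg (m k : ℕ) {x : ℝ} (hx : -1 < x) : 0 ≤ logDerivTerm m k x := by
  have hden : 0 ≤ x + (k + 1) := by linarith [k.cast_nonneg (α := ℝ)]
  rw [logDerivTerm]
  positivity

/-- The holomorphic extension of `logMultipleGamma m` to the half plane `Re z > -1`. -/
noncomputable def logWeierstrassProduct (m : ℕ) (z : ℂ) : ℂ :=
  F (m + 1) z - ∑' k : ℕ, logRemainder z ((k : ℂ) + 1) (binomPoly m 0)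

theorem differentiableOn_logWeierstrassProduct (m : ℕ) :
    DifferentiableOn ℂ (logWeierstrassProduct m) rightHalfPlane :=
  (isPolynomialOfDegreeLE_F m).differentiable.differentiableOn.sub
    (differentiableOn_tsum_logRemainder _)

theorem iteratedDeriv_logWeierstrassProduct (m : ℕ) {z : ℂ} (hz : z ∈ rightHalfPlane) :
    iteratedDeriv (m + 2) (logWeierstrassProduct m) z = -iteratedDeriv (m + 2)
      (fun z => ∑' k : ℕ, logRemainder z ((k : ℂ) + 1) (binomPoly m 0)) z := by
  have hF := isPolynomialOfDegreeLE_F m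
  have hsub : logWeierstrassProduct m = F (m + 1) -
    fun z => ∑' k : ℕ, logRemainder z ((k : ℂ) + 1) (binomPoly m 0) := rfl
  rw [hsub, iteratedDeriv_sub hF.differentiable.contDiff.contDiffAt
    (((differentiableOn_tsum_logRemainder _).contDiffOn isOpen_rightHalfPlane).contDiffAt
      (isOpen_rightHalfPlane.mem_nhds hz)),
    hF.iteratedDeriv_eq_zero (Nat.lt_succ_self _), Pi.zero_apply, zero_sub]

theorem hasSum_logDerivTerm (m : ℕ) {x : ℝ} (hx : -1 < x) :
    HasSum (fun k => logDerivTerm m k x)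
      (iteratedDeriv (m + 2) (fun t : ℝ => (logWeierstrassProduct m t).re) x) := by
  have hx_mem : (x : ℂ) ∈ rightHalfPlane := hx
  rw [iteratedDeriv_re_ofReal (differentiableOn_logWeierstrassProduct m) isOpen_rightHalfPlane _
    hx_mem, iteratedDeriv_logWeierstrassProduct m hx_mem,
    hasSum_iff_tendsto_nat_of_nonneg fun k => logDerivTerm_nonneg m k hx]
  refine ((Complex.continuous_re.tendsto _).comp (tendsto_iteratedDeriv_sum_logRemainder _
    (Nat.lt_succ_of_le (natDegree_binomPoly_le m 0)) hx_mem).neg).congr fun N => ?_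
  have hterm : ∀ k ∈ Finset.range N, -((-1) ^ (m + 1) * (m + 1).factorial /
      ((x : ℂ) + (k + 1)) ^ (m + 2) * (binomPoly m 0).eval ((k : ℂ) + 1)) =
        (logDerivTerm m k x : ℂ) := fun k _ => by
    have hsign : (-1 : ℂ) ^ m * (-1) ^ m = 1 := by rw [← mul_pow, neg_one_mul, neg_neg, one_pow]
    rw [eval_binomPoly_zero_add_one, logDerivTerm, pow_succ]
    push_cast
    linear_combination
      ((m + 1).factorial * (k + m).choose m / ((x : ℂ) + (k + 1)) ^ (m + 2)) * hsign
  rw [Function.comp_apply, ← Finset.sum_neg_distrib, Finset.sum_congr rfl hterm,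
    ← Complex.ofReal_sum, Complex.ofReal_re]

theorem tendsto_iteratedDeriv_logWeierstrassProduct (m : ℕ) :
    Tendsto (iteratedDeriv (m + 2) fun t : ℝ => (logWeierstrassProduct m t).re) atTop (𝓝 0) := by
  have hterm : ∀ k, Tendsto (logDerivTerm m k) atTop (𝓝 0) := fun k =>
    ((tendsto_pow_atTop (Nat.succ_ne_zero _)).comp
      (tendsto_atTop_add_const_right _ _ tendsto_id)).const_div_atTop _
  have hbound : ∀ᶠ x : ℝ in atTop, ∀ k, ‖logDerivTerm m k x‖ ≤ logDerivTerm m k 0 := by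
    filter_upwards [eventually_ge_atTop 0] with x hx k
    rw [Real.norm_of_nonneg (logDerivTerm_nonneg m k (by linarith)), logDerivTerm, logDerivTerm]
    gcongr
  have hlim := tendsto_tsum_of_dominated_convergence
    (hasSum_logDerivTerm m (neg_one_lt_zero (R := ℝ))).summable hterm hbound
  rw [tsum_zero] at hlim
  refine hlim.congr' ?_
  filter_upwards [eventually_ge_atTop 0] with x hx
  exact (hasSum_logDerivTerm m (by linarith)).tsum_eq

/-! ### Uniqueness of solutions of a difference equation with a monotone derivative -/

theorem iteratedDeriv_add_of_forall_add_eq {d : ℝ → ℝ} {a c : ℝ}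
    (hd : ∀ x, a < x → d (x + c) = d x) (n : ℕ) {x : ℝ} (hx : a < x) :
    iteratedDeriv n d (x + c) = iteratedDeriv n d x := by
  have hshift : (fun t => d (t + c)) =ᶠ[𝓝 x] d := by
    filter_upwards [lt_mem_nhds hx] with t ht using hd t ht
  rw [← hshift.iteratedDeriv_eq, iteratedDeriv_comp_add_const]

theorem exists_eq_const_of_iteratedDeriv_eq_const {a : ℝ} (n : ℕ) {d : ℝ → ℝ}
    (hd : ContDiffOn ℝ n d (Set.Ioi a)) (hper : ∀ x, a < x → d (x + 1) = d x)
    (hconst : ∃ c, ∀ x, a < x → iteratedDeriv n d x = c) : ∃ c, ∀ x, a < x → d x = c := by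
  induction n generalizing d with
  | zero => simpa only [iteratedDeriv_zero] using hconst
  | succ n ih =>
    have hdiff : DifferentiableOn ℝ d (Set.Ioi a) := hd.differentiableOn (by simp)
    rw [iteratedDeriv_succ'] at hconst
    obtain ⟨c, hc⟩ := ih (hd.deriv_of_isOpen isOpen_Ioi (by simp)) (fun x hx => by
      simpa only [iteratedDeriv_one] using iteratedDeriv_add_of_forall_add_eq hper 1 hx) hconst
    obtain ⟨ξ, hξ, hslope⟩ := exists_deriv_eq_slope d (lt_add_one (a + 1))
      (hdiff.continuousOn.mono fun t ht => (lt_add_one a).trans_le ht.1)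
      (hdiff.mono fun t ht => (lt_add_one a).trans ht.1)
    rw [hper _ (lt_add_one a), sub_self, zero_div, hc ξ ((lt_add_one a).trans hξ.1)] at hslope
    exact isOpen_Ioi.exists_is_const_of_deriv_eq_zero isPreconnected_Ioi hdiff
      fun x hx => (hc x hx).trans hslope

theorem tendsto_add_const_sub_of_tendsto_deriv {v : ℝ → ℝ} {a : ℝ}
    (hv : DifferentiableOn ℝ v (Set.Ioi a)) (hlim : Tendsto (deriv v) atTop (𝓝 0)) (c : ℝ) :
    Tendsto (fun x => v (x + c) - v x) atTop (𝓝 0) := by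
  rw [Metric.tendsto_nhds]
  intro ε hε
  have hc : 0 < |c| + 1 := by positivity
  obtain ⟨M, hM⟩ := eventually_atTop.mp
    ((Metric.tendsto_nhds.mp hlim _ (div_pos hε hc)).and (eventually_gt_atTop a))
  filter_upwards [eventually_ge_atTop M, eventually_ge_atTop (M - c)] with x hx hxc
  rw [dist_zero_right]
  calc ‖v (x + c) - v x‖ ≤ ε / (|c| + 1) * ‖x + c - x‖ :=
        (convex_Ici M).norm_image_sub_le_of_norm_deriv_le
          (fun t ht => (hv t (hM t ht).2).differentiableAt (Ioi_mem_nhds (hM t ht).2))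
          (fun t ht => by simpa only [dist_zero_right] using (hM t ht).1.le)
          hx (sub_le_iff_le_add.mp hxc)
    _ = ε / (|c| + 1) * |c| := by rw [add_sub_cancel_left, Real.norm_eq_abs]
    _ < ε / (|c| + 1) * (|c| + 1) := by gcongr; linarith
    _ = ε := div_mul_cancel₀ ε hc.ne'

theorem sub_eq_sub_of_monotoneOn {u v : ℝ → ℝ} {a : ℝ} (hu : MonotoneOn u (Set.Ioi a))
    (hv : MonotoneOn v (Set.Ioi a)) (hper : ∀ x, a < x → u (x + 1) - v (x + 1) = u x - v x)
    (hlim : ∀ n : ℕ, Tendsto (fun x => v (x + n) - v x) atTop (𝓝 0)) {x y : ℝ} (hx : a < x)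
    (hxy : x ≤ y) : u y - v y = u x - v x := by
  have hperiodic : ∀ (N : ℕ) (t : ℝ), a < t → u (t + N) - v (t + N) = u t - v t := by
    intro N t ht
    induction N with
    | zero => rw [Nat.cast_zero, add_zero]
    | succ N ih =>
      rw [Nat.cast_succ, ← add_assoc, hper _ (by linarith [N.cast_nonneg (α := ℝ)]), ih]
  obtain ⟨n, hn⟩ := exists_nat_ge (y - x)
  -- On `[x + N, x + N + n]` the monotone functions `u` and `v` both vary by `v (x+N+n) - v (x+N)`.
  have hbound : ∀ N : ℕ, |(u y - v y) - (u x - v x)| ≤ v (x + N + n) - v (x + N) := fun N => by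
    have hN : (0 : ℝ) ≤ N := N.cast_nonneg
    have hx_mem : x + N ∈ Set.Ioi a := lt_add_of_lt_of_nonneg hx hN
    have hle : x + N ≤ y + N := by linarith
    have hle' : y + N ≤ x + N + n := by linarith
    have hy_mem : y + N ∈ Set.Ioi a := hle.trans_lt' hx_mem
    have hn_mem : x + N + n ∈ Set.Ioi a := hle'.trans_lt' hy_mem
    rw [← hperiodic N y (hx.trans_le hxy), ← hperiodic N x hx, abs_le]
    constructor <;> linarith [hu hx_mem hy_mem hle, hu hy_mem hn_mem hle', hv hx_mem hy_mem hle,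
      hv hy_mem hn_mem hle', hperiodic n _ hx_mem]
  exact sub_eq_zero.mp (abs_nonpos_iff.mp (ge_of_tendsto'
    ((hlim n).comp (tendsto_atTop_add_const_left _ x tendsto_natCast_atTop_atTop)) hbound))

theorem differentiableOn_iteratedDeriv_of_contDiffOn {f : ℝ → ℝ} {s : Set ℝ} {m : ℕ}
    (hf : ContDiffOn ℝ (m + 1 : ℕ) f s) (hs : IsOpen s) :
    DifferentiableOn ℝ (iteratedDeriv m f) s :=
  (hf.differentiableOn_iteratedDerivWithin (by exact_mod_cast m.lt_succ_self)
    hs.uniqueDiffOn).congr fun _ hx => (iteratedDerivWithin_of_isOpen hs hx).symm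

theorem monotoneOn_iteratedDeriv {f : ℝ → ℝ} {a : ℝ} {m : ℕ}
    (hf : ContDiffOn ℝ (m + 1 : ℕ) f (Set.Ioi a))
    (hnonneg : ∀ x, a < x → 0 ≤ iteratedDeriv (m + 1) f x) :
    MonotoneOn (iteratedDeriv m f) (Set.Ioi a) := by
  have hdiff := differentiableOn_iteratedDeriv_of_contDiffOn hf isOpen_Ioi
  refine monotoneOn_of_deriv_nonneg (convex_Ioi a) hdiff.continuousOn
    (hdiff.mono interior_subset) fun x hx => ?_
  rw [← iteratedDeriv_succ]
  exact hnonneg x (interior_subset hx)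

theorem exists_sub_eq_const_of_iteratedDeriv_nonneg {f g : ℝ → ℝ} {a : ℝ} (m : ℕ)
    (hf : ContDiffOn ℝ (m + 1 : ℕ) f (Set.Ioi a)) (hg : ContDiffOn ℝ (m + 1 : ℕ) g (Set.Ioi a))
    (hper : ∀ x, a < x → f (x + 1) - g (x + 1) = f x - g x)
    (hf_nonneg : ∀ x, a < x → 0 ≤ iteratedDeriv (m + 1) f x)
    (hg_nonneg : ∀ x, a < x → 0 ≤ iteratedDeriv (m + 1) g x)
    (hlim : Tendsto (iteratedDeriv (m + 1) g) atTop (𝓝 0)) :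
    ∃ c, ∀ x, a < x → f x - g x = c := by
  have hsub : ∀ x, a < x →
      iteratedDeriv m (f - g) x = iteratedDeriv m f x - iteratedDeriv m g x := fun x hx =>
    iteratedDeriv_sub ((hf.of_le (by simp)).contDiffAt (Ioi_mem_nhds hx))
      ((hg.of_le (by simp)).contDiffAt (Ioi_mem_nhds hx))
  rw [iteratedDeriv_succ] at hlim
  have hconst : ∀ x y, a < x → x ≤ y →
      iteratedDeriv m (f - g) y = iteratedDeriv m (f - g) x := fun x y hx hxy => by
    rw [hsub y (hx.trans_le hxy), hsub x hx]
    refine sub_eq_sub_of_monotoneOn (monotoneOn_iteratedDeriv hf hf_nonneg)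
      (monotoneOn_iteratedDeriv hg hg_nonneg) (fun t ht => ?_) (fun n =>
        tendsto_add_const_sub_of_tendsto_deriv
          (differentiableOn_iteratedDeriv_of_contDiffOn hg isOpen_Ioi) hlim n) hx hxy
    rw [← hsub t ht, ← hsub (t + 1) (ht.trans (lt_add_one t)),
      iteratedDeriv_add_of_forall_add_eq hper m ht]
  refine exists_eq_const_of_iteratedDeriv_eq_const m ((hf.sub hg).of_le (by simp)) hper
    ⟨iteratedDeriv m (f - g) (a + 1), fun x hx => ?_⟩
  rcases le_total x (a + 1) with h | h
  · exact (hconst x _ hx h).symm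
  · exact hconst _ x (lt_add_one a) h

/-! ### The Weierstrass products -/

/-- The domain of holomorphy `ℂ ∖ {0, -1, -2, …}` of the multiple gamma functions. -/
def gammaDomain : Set ℂ := {z | ∀ m : ℕ, z ≠ -(m : ℂ)}

theorem compl_gammaDomain : gammaDomainᶜ = Set.range fun m : ℕ => -(m : ℂ) := by
  ext z
  simp [gammaDomain, eq_comm]

theorem isOpen_gammaDomain : IsOpen gammaDomain := by
  rw [← isClosed_compl_iff, compl_gammaDomain]
  exact ((Homeomorph.neg ℂ).isClosedEmbedding.comp (Complex.isometry_ofReal.isClosedEmbedding.comp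
    Nat.isClosedEmbedding_coe_real)).isClosed_range

theorem isPreconnected_gammaDomain : IsPreconnected gammaDomain := by
  have hcount : gammaDomainᶜ.Countable := compl_gammaDomain ▸ Set.countable_range _
  simpa only [compl_compl] using
    (hcount.isConnected_compl_of_one_lt_rank (by simp)).isPreconnected

theorem mem_gammaDomain_of_re_pos {z : ℂ} (hz : 0 < z.re) : z ∈ gammaDomain := by
  rintro m rfl
  rw [Complex.neg_re, Complex.natCast_re, neg_pos] at hz
  exact m.cast_nonneg.not_gt hz

theorem ofReal_add_one_mem_gammaDomain {x : ℝ} (hx : 0 ≤ x) : (x : ℂ) + 1 ∈ gammaDomain :=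
  mem_gammaDomain_of_re_pos (by simpa using add_pos_of_nonneg_of_pos hx one_pos)

theorem add_one_mem_gammaDomain {z : ℂ} :
    z + 1 ∈ gammaDomain ↔ ∀ k : ℕ, z ≠ -((k : ℂ) + 1) :=
  forall_congr' fun k => not_congr
    ⟨fun h => by linear_combination h, fun h => by linear_combination h⟩

theorem isOpen_preimage_gammaDomain : IsOpen {z : ℂ | z + 1 ∈ gammaDomain} :=
  isOpen_gammaDomain.preimage (continuous_add_const 1)

theorem eqOn_gammaDomain {f g : ℂ → ℂ} {a : ℝ} (hf : DifferentiableOn ℂ f gammaDomain)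
    (hg : DifferentiableOn ℂ g gammaDomain) (h : ∀ x : ℝ, a < x → f x = g x) :
    Set.EqOn f g gammaDomain := by
  set b : ℝ := max a 0 + 1
  have hb : (b : ℂ) ∈ gammaDomain := mem_gammaDomain_of_re_pos (by
    simpa using lt_add_of_le_of_pos (le_max_right a 0) one_pos)
  refine (hf.analyticOnNhd isOpen_gammaDomain).eqOn_of_preconnected_of_frequently_eq
    (hg.analyticOnNhd isOpen_gammaDomain) isPreconnected_gammaDomain hb ?_
  have htendsto : Tendsto (fun x : ℝ => (x : ℂ)) (𝓝[≠] b) (𝓝[≠] (b : ℂ)) :=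
    Complex.continuous_ofReal.continuousAt.tendsto.inf
      (tendsto_principal_principal.mpr fun _ hx => Complex.ofReal_injective.ne hx)
  refine htendsto.frequently (Eventually.frequently (nhdsWithin_le_nhds ?_))
  exact (lt_mem_nhds ((le_max_left a 0).trans_lt (lt_add_one _))).mono h

theorem weierstrassFactor_eq_exp (m : ℕ) {z : ℂ} {k : ℕ} (hk : k ≠ 0) (hz : 1 + z / k ≠ 0) :
    weierstrassFactor (m + 1) z k = Complex.exp (-logRemainder z k (binomPoly m 0)) := by
  have heval : (binomPoly m 0).eval (k : ℂ) = (Ring.choose (-(k : ℤ)) m : ℤ) := by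
    exact_mod_cast eval_binomPoly_zero_intCast m k
  rw [weierstrassFactor, Phi_succ m z hk, Nat.add_sub_cancel, logRemainder_apply, heval, neg_sub,
    sub_eq_neg_add, Complex.exp_add, neg_mul_eq_mul_neg, mul_comm (Complex.log _), ← Int.cast_neg,
    Complex.exp_int_mul, Complex.exp_log hz]

theorem exists_eventually_norm_weierstrassFactor_sub_one_le (m : ℕ) (R : ℝ) :
    ∃ C : ℝ, ∀ᶠ k : ℕ in atTop, ∀ z : ℂ, ‖z‖ ≤ R →
      ‖weierstrassFactor (m + 1) z (k + 1) - 1‖ ≤ C * (1 / ((k + 1 : ℕ) : ℝ) ^ 2) := by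
  obtain ⟨C, hC⟩ := exists_eventually_norm_logRemainder_le (binomPoly m 0) R
  refine ⟨2 * C, ?_⟩
  have hsmall : ∀ᶠ k : ℕ in atTop, C * (1 / ((k + 1 : ℕ) : ℝ) ^ 2) < 1 :=
    (summable_one_div_add_one_sq.mul_left C).tendsto_atTop_zero.eventually (gt_mem_nhds one_pos)
  filter_upwards [hC, hsmall, eventually_ge_atTop ⌈R⌉₊] with k hk hk_small hkR z hz
  have hk_pos : (0 : ℝ) < (k + 1 : ℕ) := by positivity
  have hRk : R < (k + 1 : ℕ) := (Nat.ceil_le.mp hkR).trans_lt (by norm_cast; exact k.lt_succ_self)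
  have hne : 1 + z / (k + 1 : ℕ) ≠ 0 := by
    refine Complex.slitPlane_ne_zero (Complex.mem_slitPlane_of_norm_lt_one ?_)
    rw [norm_div, Complex.norm_natCast, div_lt_one hk_pos]
    exact hz.trans_lt hRk
  have hlog : ‖-logRemainder z (k + 1 : ℕ) (binomPoly m 0)‖ ≤
      C * (1 / ((k + 1 : ℕ) : ℝ) ^ 2) := by
    rw [norm_neg, Nat.cast_add_one]
    exact hk z hz
  rw [weierstrassFactor_eq_exp m k.succ_ne_zero hne, mul_assoc]
  exact (Complex.norm_exp_sub_one_le (hlog.trans hk_small.le)).trans (by gcongr)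

theorem summable_weierstrassFactor (m : ℕ) (z : ℂ) :
    Summable fun k : ℕ => ‖weierstrassFactor (m + 1) z (k + 1) - 1‖ := by
  obtain ⟨C, hC⟩ := exists_eventually_norm_weierstrassFactor_sub_one_le m ‖z‖
  refine (summable_one_div_add_one_sq.mul_left C).of_norm_bounded_eventually_nat ?_
  filter_upwards [hC] with k hk
  rw [norm_norm]
  exact hk z le_rfl

theorem differentiableOn_weierstrassFactor (m k : ℕ) : DifferentiableOn ℂ
    (fun z => weierstrassFactor (m + 1) z (k + 1)) {z | z + 1 ∈ gammaDomain} := by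
  intro z hz
  have hk : ((k + 1 : ℕ) : ℂ) ≠ 0 := Nat.cast_ne_zero.mpr k.succ_ne_zero
  have hne : 1 + z / (k + 1 : ℕ) ≠ 0 := by
    rw [one_add_div hk, div_ne_zero_iff]
    refine ⟨fun h => add_one_mem_gammaDomain.mp hz k ?_, hk⟩
    rw [eq_neg_of_add_eq_zero_right h, Nat.cast_add_one]
  have hbase : DifferentiableAt ℂ (fun z : ℂ => 1 + z / (k + 1 : ℕ)) z := by fun_prop
  have hexp := (isPolynomialOfDegreeLE_logPrincipalPart (binomPoly m 0) hk).differentiable z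
  simp only [weierstrassFactor, Phi_succ m _ k.succ_ne_zero]
  exact ((hbase.zpow (.inl hne)).mul hexp.cexp).differentiableWithinAt

theorem differentiableOn_tprod_weierstrassFactor (m : ℕ) : DifferentiableOn ℂ
    (fun z => ∏' k : ℕ, weierstrassFactor (m + 1) z (k + 1)) {z | z + 1 ∈ gammaDomain} := by
  intro z hz
  obtain ⟨C, hC⟩ := exists_eventually_norm_weierstrassFactor_sub_one_le m (‖z‖ + 1)
  set U : Set ℂ := {z | z + 1 ∈ gammaDomain} ∩ Metric.ball 0 (‖z‖ + 1)
  have hU : IsOpen U := isOpen_preimage_gammaDomain.inter Metric.isOpen_ball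
  have hzU : z ∈ U := ⟨hz, mem_ball_zero_iff.mpr (lt_add_one _)⟩
  have hdiff : ∀ k, DifferentiableOn ℂ (fun z => weierstrassFactor (m + 1) z (k + 1)) U := fun k =>
    (differentiableOn_weierstrassFactor m k).mono Set.inter_subset_left
  have hprod := Summable.hasProdLocallyUniformlyOn_nat_one_add hU
    (summable_one_div_add_one_sq.mul_left C)
    (hC.mono fun k hk w hw => hk w (mem_ball_zero_iff.mp hw.2).le)
    (fun k => ((hdiff k).sub_const 1).continuousOn)
  simp only [add_sub_cancel] at hprod
  have hlimit := (hasProdLocallyUniformlyOn_iff_tendstoLocallyUniformlyOn.mp hprod).differentiableOn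
    (.of_forall fun s => .fun_finsetProd fun k _ => hdiff k) hU
  exact (hlimit.differentiableAt (hU.mem_nhds hzU)).differentiableWithinAt

/-- The right-hand side of the product formula for `G_{m+1}(z + 1)`. -/
noncomputable def weierstrassProduct (m : ℕ) (z : ℂ) : ℂ :=
  Complex.exp (F (m + 1) z) * ∏' k : ℕ, weierstrassFactor (m + 1) z (k + 1)

theorem differentiableOn_weierstrassProduct (m : ℕ) :
    DifferentiableOn ℂ (weierstrassProduct m) {z | z + 1 ∈ gammaDomain} :=
  (isPolynomialOfDegreeLE_F m).differentiable.cexp.differentiableOn.mul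
    (differentiableOn_tprod_weierstrassFactor m)

theorem weierstrassProduct_eq_exp (m : ℕ) {z : ℂ} (hz : z ∈ rightHalfPlane) :
    weierstrassProduct m z = Complex.exp (logWeierstrassProduct m z) := by
  have hfactor : ∀ k : ℕ, weierstrassFactor (m + 1) z (k + 1) =
      Complex.exp (-logRemainder z ((k : ℂ) + 1) (binomPoly m 0)) := fun k => by
    rw [← Nat.cast_add_one]
    refine weierstrassFactor_eq_exp m k.succ_ne_zero ?_
    rw [Nat.cast_add_one]
    exact Complex.slitPlane_ne_zero (one_add_div_mem_slitPlane hz k)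
  have hprod := (summable_logRemainder (binomPoly m 0) z).neg.hasSum.cexp.tprod_eq
  rw [weierstrassProduct, tprod_congr hfactor, logWeierstrassProduct, sub_eq_add_neg,
    Complex.exp_add, ← tsum_neg]
  exact congrArg _ hprod

theorem weierstrassProduct_ofReal (m : ℕ) {x : ℝ} (hx : -1 < x) :
    weierstrassProduct m x = Complex.exp (logMultipleGamma m x) := by
  rw [weierstrassProduct_eq_exp m hx, logWeierstrassProduct, logMultipleGamma_eq m hx]

theorem weierstrassProduct_ofReal_eq_ofReal (m : ℕ) {x : ℝ} (hx : -1 < x) :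
    weierstrassProduct m x = (Real.exp (logWeierstrassProduct m x).re : ℂ) := by
  have him : (logWeierstrassProduct m x).im = 0 := by
    rw [logWeierstrassProduct, ← logMultipleGamma_eq m hx, logMultipleGamma_im m hx]
  rw [weierstrassProduct_eq_exp m hx, Complex.ofReal_exp]
  exact congrArg _ (Complex.ext rfl him)

/-! ### The canonical hierarchy -/

/-- The canonical hierarchy of multiple gamma functions, given by the Weierstrass products. -/
noncomputable def multipleGamma : ℕ → ℂ → ℂ
  | 0, z => z
  | m + 1, z => weierstrassProduct m (z - 1)

theorem multipleGamma_succ_add_one (m : ℕ) (z : ℂ) :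
    multipleGamma (m + 1) (z + 1) = weierstrassProduct m z := by
  rw [multipleGamma, add_sub_cancel_right]

theorem differentiableOn_multipleGamma (n : ℕ) :
    DifferentiableOn ℂ (multipleGamma n) gammaDomain := by
  cases n with
  | zero => exact differentiableOn_id
  | succ m =>
    refine (differentiableOn_weierstrassProduct m).comp (differentiableOn_id.sub_const 1)
      fun z hz => ?_
    rwa [Set.mem_ofPred_eq, sub_add_cancel]

theorem multipleGamma_succ_ofReal (m : ℕ) {x : ℝ} (hx : 0 < x) :
    multipleGamma (m + 1) x = Complex.exp (logMultipleGamma m (x - 1)) := by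
  rw [multipleGamma, ← weierstrassProduct_ofReal m (by linarith), Complex.ofReal_sub,
    Complex.ofReal_one]

theorem multipleGamma_ofReal_add_one (m : ℕ) {x : ℝ} (hx : 0 < x) :
    multipleGamma (m + 1) ((x : ℂ) + 1) = multipleGamma m x * multipleGamma (m + 1) x := by
  have hx_sub : -1 < x - 1 := by linarith
  rw [← Complex.ofReal_one, ← Complex.ofReal_add, multipleGamma_succ_ofReal m (by positivity),
    multipleGamma_succ_ofReal m hx, ← sub_add_eq_add_sub x 1 1]
  cases m with
  | zero =>
    rw [logMultipleGamma_zero_add_one hx_sub, sub_add_cancel, Complex.exp_add,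
      ← Complex.ofReal_exp, Real.exp_log hx, multipleGamma, mul_comm]
  | succ m =>
    rw [logMultipleGamma_succ_add_one m hx_sub, multipleGamma_succ_ofReal m hx, Complex.exp_add,
      mul_comm]

theorem multipleGamma_add_one (n : ℕ) {z : ℂ} (hz : z ∈ gammaDomain) :
    multipleGamma (n + 1) (z + 1) = multipleGamma n z * multipleGamma (n + 1) z := by
  have hshift : DifferentiableOn ℂ (fun z => multipleGamma (n + 1) (z + 1)) gammaDomain := by
    simp only [multipleGamma_succ_add_one]
    refine (differentiableOn_weierstrassProduct n).mono fun z hz => ?_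
    exact add_one_mem_gammaDomain.mpr fun k => by exact_mod_cast hz (k + 1)
  exact eqOn_gammaDomain hshift
    ((differentiableOn_multipleGamma n).mul (differentiableOn_multipleGamma (n + 1)))
    (fun x hx => multipleGamma_ofReal_add_one n hx) hz

theorem multipleGamma_one (n : ℕ) : multipleGamma n 1 = 1 := by
  cases n with
  | zero => rfl
  | succ m =>
    rw [← Complex.ofReal_one, multipleGamma_succ_ofReal m one_pos, sub_self,
      logMultipleGamma_zero, Complex.exp_zero, Complex.ofReal_one]

theorem log_multipleGamma_succ_add_one (m : ℕ) {x : ℝ} (hx : -1 < x) :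
    Real.log (multipleGamma (m + 1) ((x : ℂ) + 1)).re = (logWeierstrassProduct m x).re := by
  rw [multipleGamma_succ_add_one, weierstrassProduct_ofReal_eq_ofReal m hx, Complex.ofReal_re,
    Real.log_exp]

theorem iteratedDeriv_log_multipleGamma_succ_add_one (m n : ℕ) {x : ℝ} (hx : -1 < x) :
    iteratedDeriv n (fun t : ℝ => Real.log (multipleGamma (m + 1) ((t : ℂ) + 1)).re) x =
      iteratedDeriv n (fun t : ℝ => (logWeierstrassProduct m t).re) x :=
  EventuallyEq.iteratedDeriv_eq n
    ((lt_mem_nhds hx).mono fun _ ht => log_multipleGamma_succ_add_one m ht)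

theorem multipleGamma_ofReal_add_one_pos (n : ℕ) {x : ℝ} (hx : -1 < x) :
    (multipleGamma n ((x : ℂ) + 1)).im = 0 ∧ 0 < (multipleGamma n ((x : ℂ) + 1)).re := by
  cases n with
  | zero => simpa [multipleGamma] using neg_lt_iff_pos_add.mp hx
  | succ m =>
    rw [multipleGamma_succ_add_one, weierstrassProduct_ofReal_eq_ofReal m hx]
    exact ⟨Complex.ofReal_im _, Real.exp_pos _⟩

theorem iteratedDeriv_log_multipleGamma_nonneg (n : ℕ) {x : ℝ} (hx : -1 < x) :
    0 ≤ iteratedDeriv (n + 1) (fun t : ℝ => Real.log (multipleGamma n ((t : ℂ) + 1)).re) x := by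
  cases n with
  | zero =>
    have hlog : (fun t : ℝ => Real.log (multipleGamma 0 ((t : ℂ) + 1)).re) =
        fun t : ℝ => Real.log (t + 1) := by
      simp only [multipleGamma, Complex.add_re, Complex.ofReal_re, Complex.one_re]
    rw [hlog, zero_add, iteratedDeriv_one, deriv_comp_add_const, Real.deriv_log, inv_nonneg]
    linarith
  | succ m =>
    rw [iteratedDeriv_log_multipleGamma_succ_add_one m _ hx]
    exact (hasSum_logDerivTerm m hx).nonneg fun k => logDerivTerm_nonneg m k hx

theorem isMultipleGammaHierarchy_multipleGamma : IsMultipleGammaHierarchy multipleGamma where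
  holomorphic := differentiableOn_multipleGamma
  zero _ := rfl
  add_one n _ hz := multipleGamma_add_one n hz
  one := multipleGamma_one
  real_pos n _ hx := multipleGamma_ofReal_add_one_pos n (neg_one_lt_zero.trans_le hx)
  log_deriv_nonneg n _ hx := iteratedDeriv_log_multipleGamma_nonneg n (neg_one_lt_zero.trans_le hx)

theorem tendsto_iteratedDeriv_log_multipleGamma (m : ℕ) :
    Tendsto (iteratedDeriv (m + 2)
      (fun t : ℝ => Real.log (multipleGamma (m + 1) ((t : ℂ) + 1)).re)) atTop (𝓝 0) :=
  (tendsto_iteratedDeriv_logWeierstrassProduct m).congr' ((eventually_gt_atTop (-1)).mono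
    fun _ hx => (iteratedDeriv_log_multipleGamma_succ_add_one m _ hx).symm)

end MultipleGamma

namespace IsMultipleGammaHierarchy

open MultipleGamma

variable {G : ℕ → ℂ → ℂ}

theorem contDiffOn_log (hG : IsMultipleGammaHierarchy G) (n k : ℕ) :
    ContDiffOn ℝ k (fun t : ℝ => Real.log (G n ((t : ℂ) + 1)).re) (Set.Ioi 0) := by
  have hre : ContDiffOn ℝ k (fun t : ℝ => (G n ((t : ℂ) + 1)).re) (Set.Ioi 0) :=
    Complex.reCLM.contDiff.comp_contDiffOn
      ((((hG.holomorphic n).contDiffOn isOpen_gammaDomain).restrict_scalars ℝ).comp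
        (Complex.ofRealCLM.contDiff.add contDiff_const).contDiffOn
        fun _ ht => ofReal_add_one_mem_gammaDomain (le_of_lt ht))
  exact hre.log fun t ht => (hG.real_pos n t (le_of_lt ht)).2.ne'

theorem log_add_one (hG : IsMultipleGammaHierarchy G) (n : ℕ) {x : ℝ} (hx : 0 ≤ x) :
    Real.log (G (n + 1) (((x + 1 : ℝ) : ℂ) + 1)).re =
      Real.log (G n ((x : ℂ) + 1)).re + Real.log (G (n + 1) ((x : ℂ) + 1)).re := by
  obtain ⟨him, hpos⟩ := hG.real_pos n x hx
  obtain ⟨-, hpos'⟩ := hG.real_pos (n + 1) x hx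
  rw [Complex.ofReal_add, Complex.ofReal_one,
    hG.add_one n _ (ofReal_add_one_mem_gammaDomain hx), Complex.mul_re, him, zero_mul, sub_zero,
    Real.log_mul hpos.ne' hpos'.ne']

theorem log_one_add_one (hG : IsMultipleGammaHierarchy G) (n : ℕ) :
    Real.log (G (n + 1) (((1 : ℝ) : ℂ) + 1)).re = 0 := by
  simpa [hG.one] using hG.log_add_one n le_rfl

theorem ofReal_exp_log (hG : IsMultipleGammaHierarchy G) (n : ℕ) {x : ℝ} (hx : 0 ≤ x) :
    (Real.exp (Real.log (G n ((x : ℂ) + 1)).re) : ℂ) = G n ((x : ℂ) + 1) := by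
  obtain ⟨him, hpos⟩ := hG.real_pos n x hx
  rw [Real.exp_log hpos]
  exact Complex.ext rfl him.symm

theorem log_eq_log_multipleGamma (hG : IsMultipleGammaHierarchy G) {n : ℕ}
    (hn : Set.EqOn (G n) (multipleGamma n) gammaDomain) {x : ℝ} (hx : 0 < x) :
    Real.log (G (n + 1) ((x : ℂ) + 1)).re =
      Real.log (multipleGamma (n + 1) ((x : ℂ) + 1)).re := by
  have hM := isMultipleGammaHierarchy_multipleGamma
  obtain ⟨c, hc⟩ := exists_sub_eq_const_of_iteratedDeriv_nonneg (n + 1)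
    (hG.contDiffOn_log (n + 1) (n + 2)) (hM.contDiffOn_log (n + 1) (n + 2))
    (fun y hy => by
      rw [hG.log_add_one n hy.le, hM.log_add_one n hy.le,
        hn (ofReal_add_one_mem_gammaDomain hy.le), add_sub_add_left_eq_sub])
    (fun y hy => hG.log_deriv_nonneg (n + 1) y hy.le)
    (fun y hy => hM.log_deriv_nonneg (n + 1) y hy.le)
    (tendsto_iteratedDeriv_log_multipleGamma n)
  have hc_zero := hc 1 one_pos
  rw [hG.log_one_add_one, hM.log_one_add_one, sub_self] at hc_zero
  exact sub_eq_zero.mp ((hc x hx).trans hc_zero.symm)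

theorem eqOn_multipleGamma (hG : IsMultipleGammaHierarchy G) (n : ℕ) :
    Set.EqOn (G n) (multipleGamma n) gammaDomain := by
  have hM := isMultipleGammaHierarchy_multipleGamma
  induction n with
  | zero => exact fun z _ => (hG.zero z).trans (hM.zero z).symm
  | succ n ih =>
    refine eqOn_gammaDomain (a := 1) (hG.holomorphic _) (hM.holomorphic _) fun x hx => ?_
    have hx_sub : 0 < x - 1 := sub_pos.mpr hx
    have hx_cast : (x : ℂ) = ((x - 1 : ℝ) : ℂ) + 1 := by
      push_cast
      ring
    rw [hx_cast, ← hG.ofReal_exp_log _ hx_sub.le, hG.log_eq_log_multipleGamma ih hx_sub,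
      hM.ofReal_exp_log _ hx_sub.le]

end IsMultipleGammaHierarchy

end

theorem theorem5p1 :
    (∃ G : ℕ → ℂ → ℂ, IsMultipleGammaHierarchy G) ∧
    ∀ G : ℕ → ℂ → ℂ, IsMultipleGammaHierarchy G →
      ∀ n : ℕ, 1 ≤ n → ∀ z : ℂ, (∀ m : ℕ, z ≠ -((m : ℂ) + 1)) →
        Summable (fun k : ℕ => ‖MultipleGamma.weierstrassFactor n z (k + 1) - 1‖) ∧
        G n (z + 1) =
          Complex.exp (MultipleGamma.F n z) *
            ∏' k : ℕ, MultipleGamma.weierstrassFactor n z (k + 1) := by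
  refine ⟨⟨MultipleGamma.multipleGamma, MultipleGamma.isMultipleGammaHierarchy_multipleGamma⟩,
    fun G hG n hn z hz => ?_⟩
  obtain ⟨m, rfl⟩ := Nat.exists_eq_add_of_le' hn
  refine ⟨MultipleGamma.summable_weierstrassFactor m z, ?_⟩
  rw [hG.eqOn_multipleGamma (m + 1) (MultipleGamma.add_one_mem_gammaDomain.mpr hz),
    MultipleGamma.multipleGamma_succ_add_one, MultipleGamma.weierstrassProduct]
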